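/- **Setting.** Let $L>0$, $\lambda_1,\lambda_2,\lambda_3>0$, $\Lambda^->0$, $\Lambda^+=\mathrm{diag}(\lambda_1,\lambda_2,\lambda_3)$, let $\Sigma^{++}$ ($3\times3$), $\Sigma^{+-}$ ($3\times1$), $\Sigma^{-+}$ ($1\times3$) be continuous on $[0,L]$, and let $Q=(q_1,q_2,q_3)^{\mathsf T}$ and $R\in\mathbb R^{1\times3}$. Consider the linear system (the linearized congested mixed-autonomy traffic model in Riemann coordinates, $\Lambda^-=-\lambda_4$) for $w=(w^+,w^-)$, $w^+(x,t)\in\mathbb R^3$, $w^-(x,t)\in\mathbb R$: $$w^+_t+\Lambda^+w^+_x=\Sigma^{++}(x)w^++\Sigma^{+-}(x)w^-,\qquad w^-_t-\Lambda^-w^-_x=\Sigma^{-+}(x)w^+,$$ $$w^+(0,t)=Qw^-(0,t),\qquad w^-(L,t)=Rw^+(L,t)+\bar U_d(t).$$ Solutions are understood along characteristics, continuous in time with values in $L^2(0,L)$, with boundary traces locally in $L^2$. Let $K=(k_1,k_2,k_3)$ and $M$ be the $C^1$ solution on $\{0\le\xi\le x\le L\}$ of the backstepping kernel equations $$\Lambda^-K_x-K_\xi\Lambda^+=K\Sigma^{++}(\xi)+M\Sigma^{-+}(\xi),\qquad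 \Lambda^-(M_x+M_\xi)=K\Sigma^{+-}(\xi),$$ $$K(x,x)(\Lambda^++\Lambda^-I)=-\Sigma^{-+}(x),\qquad \Lambda^-M(x,0)=K(x,0)\Lambda^+Q,$$ put $\alpha=w^+$, $\beta(x)=w^-(x)-\int_0^x(K(x,\xi)w^+(\xi)+M(x,\xi)w^-(\xi))\,d\xi$, $\vartheta=(\alpha,\beta)$, and let $\mathbf L$, $N$ be the continuous kernels of the inverse transformation $w^-(x)=\beta(x)+\int_0^x(\mathbf L(x,\xi)\alpha(\xi)+N(x,\xi)\beta(\xi))\,d\xi$. Let $$\bar U(t)=\int_0^L(\mathbf L(L,\xi)\alpha(\xi,t)+N(L,\xi)\beta(\xi,t))\,d\xi-Rw^+(L,t),$$ $$V(t)=\int_0^L\Big(\sum_{i=1}^3\tfrac{A_i}{\lambda_i}e^{-\mu x/\lambda_i}\alpha_i^2(x,t)+\tfrac{B}{\Lambda^-}e^{\mu x/\Lambda^-}\beta^2(x,t)\Big)dx .$$ The event-triggered control is $\bar U_d(t)=\bar U(t_k)$ for $t\in[t_k,t_{k+1})$. Put $d(t)=\bar U_d(t)-\bar U(t)$. The execution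 times are $t_0=0$ and $$t_{k+1}=\inf\{t>t_k:\ \zeta Be^{\mu L/\Lambda^-}d^2(t)\ge\zeta\mu\sigma V(t)-m(t)\}\qquad(\inf\emptyset=\infty),$$ where in this set $d(t)=\bar U(t_k)-\bar U(t)$, and where $m(0)<0$ and (in integrated form) $$\dot m=-\eta m+Be^{\mu L/\Lambda^-}d^2-\sigma\mu V-\sum_{i=1}^3\varsigma_i\alpha_i^2(L,t)-\varsigma_4\beta^2(0,t).$$ The closed loop is considered on $[0,T)$, $T=\sup_kt_k$; thus $T=\infty$ unless the execution times accumulate. Let $p_1,p_2,p_3,p_4>0$ be constants such that, for all states in $L^2((0,L);\mathbb R^4)$, $p_1\|w\|^2\le\|\vartheta\|^2\le p_2\|w\|^2$ and $p_3\|\vartheta\|^2\le V\le p_4\|\vartheta\|^2$. Put $\lambda_{\min}=\min_{1\le i\le3}\lambda_i$ and $$\gamma=\frac{2\max_iA_i}{p_3\,\lambda_{\min}}\Big(\max_{[0,L]}\|\Sigma^{++}(x)\|+\big(1+\tfrac1{p_1}\big)\max_{[0,L]}\|\Sigma^{+-}(x)\|\Big),\qquad c=\mu(1-\sigma)-\gamma,$$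 with spectral and Euclidean norms. **Theorem.** Let $A_i,B,\mu,\sigma,\zeta>0$, $\eta\in(0,1)$, $\varsigma_1,\dots,\varsigma_4\in(0,1)$ satisfy $$\varsigma_i\le A_ie^{-\mu L/\lambda_i}\ (i=1,2,3),\qquad \varsigma_4+\sum_{i=1}^3A_iq_i^2-B\le0 .$$ Then every solution of the closed loop under the event-triggered control satisfies: 1. if $c>0$, then $\|w(t)\|_{L^2}$ converges to zero exponentially, with rate $\tfrac12\min\{c,\eta\}$: there is a constant $C$ with $\|w(t)\|_{L^2}\le Ce^{-\min\{c,\eta\}t/2}$ for all $t\in[0,T)$; 2. if $c\le\eta$, then for all $t\in[0,T)$ $$\|w(t)\|_{L^2}^2\le\frac{\max\{1,p_2p_4\}}{p_1p_3}\,e^{-(\mu(1-\sigma)-\gamma)t}\big(\|w(0)\|_{L^2}^2-m(0)\big).$$ In particular, if $p_2p_4\ge1$ (which can always be arranged by enlarging $p_2$), the constant is $p_2p_4/(p_1p_3)$. -/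

import Mathlib

open MeasureTheory Set Filter Topology

noncomputable section

namespace MixedTraffic

/-- Coefficients of the linear hyperbolic boundary control system on `[0, L]`
`w⁺_t + Λ⁺ w⁺_x = Σ⁺⁺(x) w⁺ + Σ⁺⁻(x) w⁻`, `w⁻_t - Λ⁻ w⁻_x = Σ⁻⁺(x) w⁺`,
`w⁺(0,t) = Q w⁻(0,t)`, `w⁻(L,t) = R w⁺(L,t) + input`, with three rightgoing components
`w⁺` (speeds `lam i = λ_i > 0`) and one leftgoing component `w⁻` (speed `Λ⁻ = -λ₄ > 0`,
the congested regime). -/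
structure Plant where
  L : ℝ
  lam : Fin 3 → ℝ
  lamMinus : ℝ
  Spp : ℝ → Matrix (Fin 3) (Fin 3) ℝ
  Spm : ℝ → Fin 3 → ℝ
  Smp : ℝ → Fin 3 → ℝ
  Q : Fin 3 → ℝ
  R : Fin 3 → ℝ
  L_pos : 0 < L
  lam_pos : ∀ i, 0 < lam i
  lamMinus_pos : 0 < lamMinus
  Spp_cont : ∀ i j, ContinuousOn (fun x => Spp x i j) (Icc 0 L)
  Spm_cont : ∀ i, ContinuousOn (fun x => Spm x i) (Icc 0 L)
  Smp_cont : ∀ i, ContinuousOn (fun x => Smp x i) (Icc 0 L)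

/-- The design parameters of the Lyapunov functional and of the triggering mechanism. -/
structure Design where
  A : Fin 3 → ℝ
  B : ℝ
  μ : ℝ
  σ : ℝ
  ζ : ℝ
  η : ℝ
  ς : Fin 3 → ℝ
  ς₄ : ℝ

/-- The spatial profile `(a, b)` (three components and one component) is in `L²((0,L); ℝ⁴)`. -/
def InL2 (L : ℝ) (a : ℝ → Fin 3 → ℝ) (b : ℝ → ℝ) : Prop :=
  (∀ i, MemLp (fun x => a x i) 2 (volume.restrict (Ioc 0 L))) ∧
    MemLp b 2 (volume.restrict (Ioc 0 L))

/-- The squared norm of a profile in `L²((0,L); ℝ⁴)`. -/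
def normSq (L : ℝ) (a : ℝ → Fin 3 → ℝ) (b : ℝ → ℝ) : ℝ :=
  ∫ x in (0 : ℝ)..L, ((∑ i, a x i ^ 2) + b x ^ 2)

/-- The triangle `{(x, ξ) : 0 ≤ ξ ≤ x ≤ L}`. -/
def triangle (L : ℝ) : Set (ℝ × ℝ) := {p | 0 ≤ p.2 ∧ p.2 ≤ p.1 ∧ p.1 ≤ L}

/-- The Volterra term `∫₀ˣ (G(x,ξ) a(ξ) + H(x,ξ) b(ξ)) dξ` with kernels
`G = (G₁, G₂, G₃)` and `H`. -/
def volterra (G : Fin 3 → ℝ × ℝ → ℝ) (H : ℝ × ℝ → ℝ)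
    (a : ℝ → Fin 3 → ℝ) (b : ℝ → ℝ) (x : ℝ) : ℝ :=
  ∫ ξ in (0 : ℝ)..x, ((∑ i, G i (x, ξ) * a ξ i) + H (x, ξ) * b ξ)

/-- The last component `β` of the backstepping transformation of `w = (a, b)`; the first three
components are unchanged, `α = w⁺ = a`. -/
def backstep (K : Fin 3 → ℝ × ℝ → ℝ) (M : ℝ × ℝ → ℝ)
    (a : ℝ → Fin 3 → ℝ) (b : ℝ → ℝ) (x : ℝ) : ℝ :=
  b x - volterra K M a b x

/-- The last component `w⁻` of the inverse transformation of `ϑ = (a, β)`. -/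
def invBackstep (G : Fin 3 → ℝ × ℝ → ℝ) (N : ℝ × ℝ → ℝ)
    (a : ℝ → Fin 3 → ℝ) (β : ℝ → ℝ) (x : ℝ) : ℝ :=
  β x + volterra G N a β x

/-- `(K, M)` is the classical solution on the triangle of the backstepping kernel equations
`Λ⁻ K_x - K_ξ Λ⁺ = K Σ⁺⁺(ξ) + M Σ⁻⁺(ξ)`, `Λ⁻ (M_x + M_ξ) = K Σ⁺⁻(ξ)`,
`K(x,x) (Λ⁺ + Λ⁻ I) = -Σ⁻⁺(x)`, `Λ⁻ M(x,0) = K(x,0) Λ⁺ Q`,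
which express that `β` is transported freely, `β_t - Λ⁻ β_x = 0`. -/
structure IsBacksteppingKernel (P : Plant) (K : Fin 3 → ℝ × ℝ → ℝ) (M : ℝ × ℝ → ℝ) : Prop where
  K_smooth : ∀ i, ContDiffOn ℝ 1 (K i) (triangle P.L)
  M_smooth : ContDiffOn ℝ 1 M (triangle P.L)
  K_eq : ∀ i, ∀ p ∈ triangle P.L,
    P.lamMinus * fderivWithin ℝ (K i) (triangle P.L) p (1, 0)
        - P.lam i * fderivWithin ℝ (K i) (triangle P.L) p (0, 1)
      = (∑ j, K j p * P.Spp p.2 j i) + M p * P.Smp p.2 i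
  M_eq : ∀ p ∈ triangle P.L,
    P.lamMinus * (fderivWithin ℝ M (triangle P.L) p (1, 0)
        + fderivWithin ℝ M (triangle P.L) p (0, 1))
      = ∑ j, K j p * P.Spm p.2 j
  K_diag : ∀ i, ∀ x ∈ Icc 0 P.L, K i (x, x) * (P.lam i + P.lamMinus) = - P.Smp x i
  M_bdry : ∀ x ∈ Icc 0 P.L, P.lamMinus * M (x, 0) = ∑ i, K i (x, 0) * P.lam i * P.Q i

/-- `(G, N)` are the (continuous) kernels of the inverse of the backstepping transformation with
kernels `(K, M)`. -/
structure IsInverseKernel (P : Plant) (K : Fin 3 → ℝ × ℝ → ℝ) (M : ℝ × ℝ → ℝ)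
    (G : Fin 3 → ℝ × ℝ → ℝ) (N : ℝ × ℝ → ℝ) : Prop where
  G_cont : ∀ i, ContinuousOn (G i) (triangle P.L)
  N_cont : ContinuousOn N (triangle P.L)
  left_inv : ∀ a b, InL2 P.L a b → ∀ x ∈ Icc 0 P.L,
    invBackstep G N a (backstep K M a b) x = b x
  right_inv : ∀ a β, InL2 P.L a β → ∀ x ∈ Icc 0 P.L,
    backstep K M a (invBackstep G N a β) x = β x

/-- The continuous-time backstepping feedback evaluated at the profile `w = (a, b)`:
`∫₀ᴸ (G(L,ξ) α(ξ) + N(L,ξ) β(ξ)) dξ - R w⁺(L)`. -/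
def feedback (P : Plant) (K : Fin 3 → ℝ × ℝ → ℝ) (M : ℝ × ℝ → ℝ)
    (G : Fin 3 → ℝ × ℝ → ℝ) (N : ℝ × ℝ → ℝ) (a : ℝ → Fin 3 → ℝ) (b : ℝ → ℝ) : ℝ :=
  volterra G N a (backstep K M a b) P.L - ∑ i, P.R i * a P.L i

/-- The Lyapunov functional `V` at the target profile `ϑ = (α, β)`. -/
def lyapunov (P : Plant) (D : Design) (α : ℝ → Fin 3 → ℝ) (β : ℝ → ℝ) : ℝ :=
  ∫ x in (0 : ℝ)..P.L,
    ((∑ i, D.A i / P.lam i * Real.exp (-(D.μ * x / P.lam i)) * α x i ^ 2)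
      + D.B / P.lamMinus * Real.exp (D.μ * x / P.lamMinus) * β x ^ 2)

/-- The triggering inequality `ζ B e^{μL/Λ⁻} d² ≥ ζ μ σ V - m`. -/
def Triggered (P : Plant) (D : Design) (d V m : ℝ) : Prop :=
  D.ζ * D.B * Real.exp (D.μ * P.L / P.lamMinus) * d ^ 2 ≥ D.ζ * D.μ * D.σ * V - m

/-- The right-hand side of the differential equation for `m`. -/
def mRate (P : Plant) (D : Design) (m d V : ℝ) (αL : Fin 3 → ℝ) (β0 : ℝ) : ℝ :=
  - D.η * m + D.B * Real.exp (D.μ * P.L / P.lamMinus) * d ^ 2 - D.σ * D.μ * V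
    - (∑ i, D.ς i * αL i ^ 2) - D.ς₄ * β0 ^ 2

/-- The time domain `[0, T)`, with `T = ∞` allowed. -/
def timeDomain (T : EReal) : Set ℝ := {t | 0 ≤ t ∧ (t : EReal) < T}

/-- `(u, v)`, written `u t x = w⁺(x,t)` and `v t x = w⁻(x,t)`, is an `L²` solution on `[0, T)`,
in the sense of characteristics, of the system with boundary input `U`: it is continuous in time
with values in `L²`, has boundary traces locally in `L²`, satisfies the boundary conditions, and
along almost every characteristic line each component is the integral of its source term. -/
structure IsSolution (P : Plant) (T : EReal) (U : ℝ → ℝ)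
    (u : ℝ → ℝ → Fin 3 → ℝ) (v : ℝ → ℝ → ℝ) : Prop where
  meas_u : ∀ i, Measurable (fun p : ℝ × ℝ => u p.1 p.2 i)
  meas_v : Measurable (fun p : ℝ × ℝ => v p.1 p.2)
  inL2 : ∀ t ∈ timeDomain T, InL2 P.L (u t) (v t)
  cont : ∀ t₀ ∈ timeDomain T,
    Tendsto (fun t => normSq P.L (u t - u t₀) (v t - v t₀)) (𝓝[timeDomain T] t₀) (𝓝 0)
  trace : ∀ t ∈ timeDomain T,
    (∀ i, IntervalIntegrable (fun s => u s 0 i ^ 2) volume 0 t ∧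
      IntervalIntegrable (fun s => u s P.L i ^ 2) volume 0 t) ∧
    IntervalIntegrable (fun s => v s 0 ^ 2) volume 0 t ∧
    IntervalIntegrable (fun s => v s P.L ^ 2) volume 0 t
  char_u : ∀ i, ∀ᵐ c : ℝ, ∀ s ∈ timeDomain T, ∀ t ∈ timeDomain T, s ≤ t →
    c + P.lam i * s ∈ Icc 0 P.L → c + P.lam i * t ∈ Icc 0 P.L →
    IntervalIntegrable (fun r => (∑ j, P.Spp (c + P.lam i * r) i j * u r (c + P.lam i * r) j)
        + P.Spm (c + P.lam i * r) i * v r (c + P.lam i * r)) volume s t ∧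
    u t (c + P.lam i * t) i = u s (c + P.lam i * s) i +
      ∫ r in s..t, ((∑ j, P.Spp (c + P.lam i * r) i j * u r (c + P.lam i * r) j)
        + P.Spm (c + P.lam i * r) i * v r (c + P.lam i * r))
  char_v : ∀ᵐ c : ℝ, ∀ s ∈ timeDomain T, ∀ t ∈ timeDomain T, s ≤ t →
    c - P.lamMinus * s ∈ Icc 0 P.L → c - P.lamMinus * t ∈ Icc 0 P.L →
    IntervalIntegrable (fun r => ∑ j, P.Smp (c - P.lamMinus * r) j * u r (c - P.lamMinus * r) j)
      volume s t ∧
    v t (c - P.lamMinus * t) = v s (c - P.lamMinus * s) +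
      ∫ r in s..t, ∑ j, P.Smp (c - P.lamMinus * r) j * u r (c - P.lamMinus * r) j
  bdry_zero : ∀ t ∈ timeDomain T, ∀ i, u t 0 i = P.Q i * v t 0
  bdry_L : ∀ t ∈ timeDomain T, v t P.L = (∑ i, P.R i * u t P.L i) + U t

/-- The closed loop under the event-triggered feedback. The data are the state `(u, v)`, the
applied input `Ud`, the auxiliary variable `m` and the execution times `tk` (`tk k = ⊤` if there
are at most `k - 1` events after time `0`). The closed loop lives on `[0, T)`, where
`T = sup_k tk k`, so that `T = ∞` unless the execution times accumulate. -/
structure IsClosedLoop (P : Plant) (D : Design) (K : Fin 3 → ℝ × ℝ → ℝ) (M : ℝ × ℝ → ℝ)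
    (G : Fin 3 → ℝ × ℝ → ℝ) (N : ℝ × ℝ → ℝ)
    (u : ℝ → ℝ → Fin 3 → ℝ) (v : ℝ → ℝ → ℝ) (Ud m : ℝ → ℝ) (tk : ℕ → EReal) : Prop where
  solution : IsSolution P (⨆ k, tk k) Ud u v
  time_zero : tk 0 = 0
  /-- the feedback is sampled at `tk k` and held until `tk (k + 1)` -/
  hold : ∀ k, ∀ t : ℝ, tk k ≤ (t : EReal) → (t : EReal) < tk (k + 1) →
    Ud t = feedback P K M G N (u (tk k).toReal) (v (tk k).toReal)
  /-- the next execution time is the infimum (`⊤` for the empty set) of the later times at which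
  the input held since `tk k` violates the triggering bound -/
  next : ∀ k, tk (k + 1) = sInf ((fun t : ℝ => (t : EReal)) '' {t : ℝ | tk k < (t : EReal) ∧
    Triggered P D
      (feedback P K M G N (u (tk k).toReal) (v (tk k).toReal) - feedback P K M G N (u t) (v t))
      (lyapunov P D (u t) (backstep K M (u t) (v t))) (m t)})
  m_zero : m 0 < 0
  m_eq : ∀ t ∈ timeDomain (⨆ k, tk k),
    IntervalIntegrable (fun s => mRate P D (m s) (Ud s - feedback P K M G N (u s) (v s))
      (lyapunov P D (u s) (backstep K M (u s) (v s))) (u s P.L)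
      (backstep K M (u s) (v s) 0)) volume 0 t ∧
    m t = m 0 + ∫ s in (0 : ℝ)..t,
      mRate P D (m s) (Ud s - feedback P K M G N (u s) (v s))
        (lyapunov P D (u s) (backstep K M (u s) (v s))) (u s P.L)
        (backstep K M (u s) (v s) 0)

/-- `max_{x ∈ [0,L]} ‖Σ⁺⁺(x)‖`, spectral norm. -/
def supSpp (P : Plant) : ℝ :=
  sSup ((fun x => ‖Matrix.toEuclideanCLM (𝕜 := ℝ) (P.Spp x)‖) '' Icc 0 P.L)

/-- `max_{x ∈ [0,L]} ‖Σ⁺⁻(x)‖`, Euclidean norm. -/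
def supSpm (P : Plant) : ℝ :=
  sSup ((fun x => ‖WithLp.toLp 2 (P.Spm x)‖) '' Icc 0 P.L)

/-- The constant `γ = 2 A / (p₃ min λ_i) (max ‖Σ⁺⁺‖ + (1 + 1/p₁) max ‖Σ⁺⁻‖)`, `A = max A_i`. -/
def gammaConst (P : Plant) (D : Design) (p₁ p₃ : ℝ) : ℝ :=
  2 * (⨆ i, D.A i) / (p₃ * ⨅ i, P.lam i) * (supSpp P + (1 + 1 / p₁) * supSpm P)

/-- The rate `μ (1 - σ) - γ`. -/
def decayRate (P : Plant) (D : Design) (p₁ p₃ : ℝ) : ℝ :=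
  D.μ * (1 - D.σ) - gammaConst P D p₁ p₃

/-- `p₁ ‖w‖² ≤ ‖ϑ‖² ≤ p₂ ‖w‖²` for all `w` in `L²`, `ϑ` being the transform of `w`. -/
def TransformBounds (P : Plant) (K : Fin 3 → ℝ × ℝ → ℝ) (M : ℝ × ℝ → ℝ) (p₁ p₂ : ℝ) : Prop :=
  ∀ a b, InL2 P.L a b →
    p₁ * normSq P.L a b ≤ normSq P.L a (backstep K M a b) ∧
      normSq P.L a (backstep K M a b) ≤ p₂ * normSq P.L a b

/-- `p₃ ‖ϑ‖² ≤ V ≤ p₄ ‖ϑ‖²` for all `ϑ` in `L²`. -/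
def LyapunovBounds (P : Plant) (D : Design) (p₃ p₄ : ℝ) : Prop :=
  ∀ α β, InL2 P.L α β →
    p₃ * normSq P.L α β ≤ lyapunov P D α β ∧ lyapunov P D α β ≤ p₄ * normSq P.L α β

/-- Exponential convergence to zero on `[0, T)` in the `L²` norm at the rate `κ`. -/
def ExpConverges (L : ℝ) (κ : ℝ) (T : EReal) (u : ℝ → ℝ → Fin 3 → ℝ) (v : ℝ → ℝ → ℝ) : Prop :=
  ∃ C : ℝ, ∀ t ∈ timeDomain T, Real.sqrt (normSq L (u t) (v t)) ≤ C * Real.exp (-(κ * t))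

end MixedTraffic

end

/-!
In the backstepping coordinates `β` solves `β_t - Λ⁻ β_x = 0`, with boundary value `β(L, t) = d(t)`
equal to the actuation error. Hence `V' ≤ (γ - μ) V + B e^{μL/Λ⁻} d²` up to boundary terms. The `d²`
terms of `V'` and `m'` cancel in `V - m`, and the remaining boundary terms are nonpositive by the
conditions on `ς`, `A` and `B`, so `(V - m)' ≤ -c V + η m`. Since the triggering inequality fails
between execution times, `m` stays negative, and therefore `(V - m)' ≤ -min {c, η} (V - m)`.

For solutions along characteristics these derivatives are replaced by the balance law of a transport
equation on a trapezoid `0 ≤ x ≤ e - ω t`: integrating the source over the trapezoid along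
characteristic lines gives the difference of the exit and entry traces. Applied to weighted squares
with `ω = 0`, it yields the evolution of `V`. Applied to kernel times solution, with the slanted
edge on a characteristic of `β`, it yields that of the Volterra integral, and the kernel equations
reduce its rate to `Σ⁻⁺ w⁺`.
-/

noncomputable section

namespace MixedTraffic

/-- `g` is on `[s, t]` an indefinite integral of the integrable function `f`: the weak form of
`g' = f` in which all evolution laws of `L²` solutions are expressed. -/
def IsPrimitive (g f : ℝ → ℝ) (s t : ℝ) : Prop :=
  IntervalIntegrable f volume s t ∧ ∀ r ∈ Icc s t, g r = g s + ∫ x in s..r, f x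

namespace IsPrimitive

variable {g f g₁ f₁ g₂ f₂ : ℝ → ℝ} {s t s' t' : ℝ}

theorem integral_eq (h : IsPrimitive g f s t) (hst : s ≤ t) : g t = g s + ∫ x in s..t, f x :=
  h.2 t (right_mem_Icc.2 hst)

theorem mono (h : IsPrimitive g f s t) (h₁ : s ≤ s') (h₂ : s' ≤ t') (h₃ : t' ≤ t) :
    IsPrimitive g f s' t' := by
  have hint : ∀ a ∈ Icc s t, ∀ b ∈ Icc s t, IntervalIntegrable f volume a b := fun a ha b hb =>
    h.1.mono_set (by
      rw [uIcc_of_le (h₁.trans (h₂.trans h₃))]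
      exact uIcc_subset_Icc ha hb)
  have hs' : s' ∈ Icc s t := ⟨h₁, h₂.trans h₃⟩
  have ht' : t' ∈ Icc s t := ⟨h₁.trans h₂, h₃⟩
  refine ⟨hint _ hs' _ ht', fun r hr => ?_⟩
  have hr' : r ∈ Icc s t := ⟨h₁.trans hr.1, hr.2.trans h₃⟩
  rw [h.2 r hr', h.2 s' hs', add_assoc, intervalIntegral.integral_add_adjacent_intervals
    (hint _ (left_mem_Icc.2 (h₁.trans (h₂.trans h₃))) _ hs') (hint _ hs' _ hr')]

theorem congr (h : IsPrimitive g₁ f₁ s t) (hst : s ≤ t) (hg : ∀ r ∈ Icc s t, g₁ r = g₂ r)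
    (hf : ∀ r ∈ Icc s t, f₁ r = f₂ r) : IsPrimitive g₂ f₂ s t := by
  have hf' : ∀ r ∈ Icc s t, EqOn f₁ f₂ (uIcc s r) := fun r hr x hx => by
    rw [uIcc_of_le hr.1] at hx
    exact hf x ⟨hx.1, hx.2.trans hr.2⟩
  refine ⟨h.1.congr fun x hx => hf' t (right_mem_Icc.2 hst) (uIoc_subset_uIcc hx),
    fun r hr => ?_⟩
  rw [← hg r hr, ← hg s (left_mem_Icc.2 hst), h.2 r hr,
    intervalIntegral.integral_congr (hf' r hr)]

theorem const (c s t : ℝ) : IsPrimitive (fun _ => c) (fun _ => 0) s t :=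
  ⟨intervalIntegrable_const, fun r _ => by simp⟩

theorem continuousOn (h : IsPrimitive g f s t) (hst : s ≤ t) : ContinuousOn g (Icc s t) := by
  have := intervalIntegral.continuousOn_primitive_interval' h.1 left_mem_uIcc
  rw [uIcc_of_le hst] at this
  exact (continuousOn_const.add this).congr fun r hr => h.2 r hr

theorem add (h₁ : IsPrimitive g₁ f₁ s t) (h₂ : IsPrimitive g₂ f₂ s t) :
    IsPrimitive (fun r => g₁ r + g₂ r) (fun r => f₁ r + f₂ r) s t := by
  refine ⟨h₁.1.add h₂.1, fun r hr => ?_⟩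
  have h₁r := h₁.mono le_rfl hr.1 hr.2
  have h₂r := h₂.mono le_rfl hr.1 hr.2
  rw [intervalIntegral.integral_add h₁r.1 h₂r.1]
  linear_combination h₁r.integral_eq hr.1 + h₂r.integral_eq hr.1

theorem neg (h : IsPrimitive g f s t) : IsPrimitive (fun r => -g r) (fun r => -f r) s t :=
  ⟨h.1.neg, fun r hr => by
    rw [intervalIntegral.integral_neg]
    linear_combination -h.2 r hr⟩

theorem sub (h₁ : IsPrimitive g₁ f₁ s t) (h₂ : IsPrimitive g₂ f₂ s t) :
    IsPrimitive (fun r => g₁ r - g₂ r) (fun r => f₁ r - f₂ r) s t := by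
  simpa only [sub_eq_add_neg] using h₁.add h₂.neg

theorem sum {ι : Type*} {g f : ι → ℝ → ℝ} (S : Finset ι)
    (h : ∀ i ∈ S, IsPrimitive (g i) (f i) s t) :
    IsPrimitive (fun r => ∑ i ∈ S, g i r) (fun r => ∑ i ∈ S, f i r) s t := by
  classical
  induction S using Finset.induction_on with
  | empty => simpa only [Finset.sum_empty] using const 0 s t
  | insert a S ha ih =>
    simp only [Finset.sum_insert ha]
    exact (h a (Finset.mem_insert_self a S)).add
      (ih fun i hi => h i (Finset.mem_insert_of_mem hi))

theorem comp_neg (h : IsPrimitive g f s t) :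
    IsPrimitive (fun r => g (-r)) (fun r => -f (-r)) (-t) (-s) := by
  refine ⟨((IntervalIntegrable.iff_comp_neg (by finiteness)).1 h.1).symm.neg, fun r hr => ?_⟩
  have hr' : -r ∈ Icc s t := ⟨by linarith [hr.2], by linarith [hr.1]⟩
  have := (h.mono hr'.1 hr'.2 le_rfl).integral_eq hr'.2
  rw [intervalIntegral.integral_neg, intervalIntegral.integral_comp_neg, neg_neg]
  dsimp only
  rw [neg_neg]
  linarith

theorem of_hasDerivWithinAt (hst : s ≤ t) (hf : ContinuousOn f (Icc s t))
    (hd : ∀ r ∈ Icc s t, HasDerivWithinAt g (f r) (Icc s t) r) : IsPrimitive g f s t := by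
  refine ⟨(uIcc_of_le hst ▸ hf).intervalIntegrable, fun r hr => ?_⟩
  have hsub : Icc s r ⊆ Icc s t := Icc_subset_Icc_right hr.2
  rw [intervalIntegral.integral_eq_sub_of_hasDerivAt_of_le hr.1
    (fun x hx => ((hd x (hsub hx)).continuousWithinAt).mono hsub)
    (fun x hx => (hd x (hsub (Ioo_subset_Icc_self hx))).hasDerivAt
      (Icc_mem_nhds hx.1 (hx.2.trans_le hr.2)))
    ((uIcc_of_le hr.1 ▸ hf.mono hsub).intervalIntegrable)]
  ring

theorem integral_by_parts (h₁ : IsPrimitive g₁ f₁ s t) (h₂ : IsPrimitive g₂ f₂ s t)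
    (hst : s ≤ t) :
    ∫ x in s..t, (f₁ x * g₂ x + g₁ x * f₂ x) = g₁ t * g₂ t - g₁ s * g₂ s := by
  have ac : ∀ {g f : ℝ → ℝ}, IsPrimitive g f s t →
      AbsolutelyContinuousOnInterval (fun x => g s + ∫ y in s..x, f y) s t := fun h =>
    ((LipschitzWith.const _).lipschitzOnWith.absolutelyContinuousOnInterval (K := 0)).fun_add
      (h.1.absolutelyContinuousOnInterval_intervalIntegral left_mem_uIcc)
  have ae_deriv : ∀ {g f : ℝ → ℝ}, IsPrimitive g f s t → ∀ᵐ x, x ∈ uIcc s t →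
      deriv (fun x => g s + ∫ y in s..x, f y) x = f x := fun h => by
    filter_upwards [h.1.ae_hasDerivAt_integral] with x hx hxm
    exact ((hx hxm s left_mem_uIcc).const_add _).deriv
  have key := (ac h₁).integral_deriv_mul_eq_sub (ac h₂)
  simp only [intervalIntegral.integral_same, add_zero] at key
  rw [h₁.integral_eq hst, h₂.integral_eq hst, ← key]
  refine intervalIntegral.integral_congr_ae ?_
  filter_upwards [ae_deriv h₁, ae_deriv h₂] with x hx₁ hx₂ hx
  have hx' := uIoc_subset_uIcc hx
  have hx'' : x ∈ Icc s t := by rwa [uIcc_of_le hst] at hx'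
  rw [hx₁ hx', hx₂ hx', ← h₁.2 x hx'', ← h₂.2 x hx'']

theorem mul (h₁ : IsPrimitive g₁ f₁ s t) (h₂ : IsPrimitive g₂ f₂ s t) (hst : s ≤ t) :
    IsPrimitive (fun r => g₁ r * g₂ r) (fun r => f₁ r * g₂ r + g₁ r * f₂ r) s t := by
  refine ⟨(h₁.1.mul_continuousOn ?_).add (h₂.1.continuousOn_mul ?_), fun r hr => ?_⟩
  · rw [uIcc_of_le hst]; exact h₂.continuousOn hst
  · rw [uIcc_of_le hst]; exact h₁.continuousOn hst
  · linear_combination -integral_by_parts (h₁.mono le_rfl hr.1 hr.2)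
      (h₂.mono le_rfl hr.1 hr.2) hr.1

theorem gronwall_le (h : IsPrimitive g f s t) (hst : s ≤ t) {κ : ℝ}
    (hle : ∀ᵐ r, r ∈ Ioc s t → f r ≤ -κ * g r) : g t ≤ Real.exp (-κ * (t - s)) * g s := by
  have hexp : IsPrimitive (fun r => Real.exp (κ * (r - s)))
      (fun r => Real.exp (κ * (r - s)) * κ) s t := by
    refine of_hasDerivWithinAt hst (by fun_prop) fun r _ => ?_
    have : HasDerivAt (fun r => κ * (r - s)) κ r := by
      simpa using ((hasDerivAt_id r).sub_const s).const_mul κ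
    exact this.exp.hasDerivWithinAt
  have hrate : ∫ x in s..t, (Real.exp (κ * (x - s)) * κ * g x + Real.exp (κ * (x - s)) * f x)
      ≤ 0 := by
    rw [intervalIntegral.integral_of_le hst]
    refine integral_nonpos_of_ae ?_
    rw [EventuallyLE, ae_restrict_iff' measurableSet_Ioc]
    filter_upwards [hle] with r hr hrm
    have := mul_le_mul_of_nonneg_left (hr hrm) (Real.exp_pos (κ * (r - s))).le
    simp only [Pi.zero_apply]
    linarith
  have hdecr : Real.exp (κ * (t - s)) * g t ≤ g s := by
    have := (hexp.mul h hst).integral_eq hst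
    simp only [sub_self, mul_zero, Real.exp_zero, one_mul] at this
    linarith
  calc g t = Real.exp (-κ * (t - s)) * (Real.exp (κ * (t - s)) * g t) := by
        rw [← mul_assoc, ← Real.exp_add]; simp
    _ ≤ _ := mul_le_mul_of_nonneg_left hdecr (Real.exp_pos _).le

end IsPrimitive

theorem measurePreserving_shear (κ : ℝ) :
    MeasurePreserving (fun p : ℝ × ℝ => (p.1, p.2 + κ * p.1)) volume volume := by
  have := (MeasurePreserving.id (volume : Measure ℝ)).skew_product (μc := volume) (μd := volume)
    (g := fun r b => b + κ * r) (by fun_prop)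
    (ae_of_all _ fun r => (measurePreserving_add_right volume (κ * r)).map_eq)
  simpa [Measure.volume_eq_prod] using this

theorem measurableEmbedding_shear (κ : ℝ) :
    MeasurableEmbedding (fun p : ℝ × ℝ => (p.1, p.2 + κ * p.1)) := by
  refine MeasurableEmbedding.of_measurable_inverse (g := fun p => (p.1, p.2 - κ * p.1))
    (by fun_prop) ?_ (by fun_prop) fun p => by simp
  convert MeasurableSet.univ
  exact range_eq_univ.2 fun p => ⟨(p.1, p.2 - κ * p.1), by simp⟩

section Lines

variable {F : ℝ → ℝ → ℝ} {S : Set (ℝ × ℝ)}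

theorem indicator_line (F : ℝ → ℝ → ℝ) (S : Set (ℝ × ℝ)) (κ b : ℝ) :
    (fun r => S.indicator (fun p => F p.1 p.2) (r, b + κ * r))
      = {r | (r, b + κ * r) ∈ S}.indicator fun r => F r (b + κ * r) := by
  ext r
  by_cases hr : (r, b + κ * r) ∈ S <;> simp [indicator, hr]

theorem measurableSet_line (hS : MeasurableSet S) (κ b : ℝ) :
    MeasurableSet {r : ℝ | (r, b + κ * r) ∈ S} := by
  have : Measurable fun r : ℝ => (r, b + κ * r) := by fun_prop
  exact this hS

theorem integrable_indicator_shear (hS : MeasurableSet S)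
    (hF : IntegrableOn (fun p => F p.1 p.2) S) (κ : ℝ) :
    Integrable (fun p : ℝ × ℝ => S.indicator (fun p => F p.1 p.2) (p.1, p.2 + κ * p.1))
      (volume.prod volume) := by
  have h := ((measurePreserving_shear κ).integrable_comp_emb (measurableEmbedding_shear κ)).2
    (hF.integrable_indicator hS)
  rwa [Measure.volume_eq_prod] at h

theorem ae_integrableOn_line (hS : MeasurableSet S)
    (hF : IntegrableOn (fun p => F p.1 p.2) S) (κ : ℝ) :
    ∀ᵐ b : ℝ, IntegrableOn (fun r => F r (b + κ * r)) {r | (r, b + κ * r) ∈ S} := by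
  filter_upwards [(integrable_indicator_shear hS hF κ).prod_left_ae] with b hb
  rwa [indicator_line, integrable_indicator_iff (measurableSet_line hS κ b)] at hb

theorem setIntegral_eq_integral_line (hS : MeasurableSet S)
    (hF : IntegrableOn (fun p => F p.1 p.2) S) (κ : ℝ) :
    ∫ p in S, F p.1 p.2 = ∫ b, ∫ r in {r | (r, b + κ * r) ∈ S}, F r (b + κ * r) := by
  rw [← integral_indicator hS, ← (measurePreserving_shear κ).integral_comp
    (measurableEmbedding_shear κ), Measure.volume_eq_prod,
    integral_prod_symm _ (integrable_indicator_shear hS hF κ)]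
  refine integral_congr_ae (ae_of_all _ fun b => ?_)
  simp only [indicator_line, integral_indicator (measurableSet_line hS κ b)]

end Lines

/-- The region swept during the time interval `[s, t]` by the space interval `[0, e - ω r]`,
whose right end moves at speed `-ω`. -/
def trapezoid (e ω s t : ℝ) : Set (ℝ × ℝ) := {p | p.1 ∈ Icc s t ∧ p.2 ∈ Icc 0 (e - ω * p.1)}

section Trapezoid

variable {e ω s t κ b r : ℝ} {F : ℝ → ℝ → ℝ}

theorem isCompact_trapezoid (e ω s t : ℝ) : IsCompact (trapezoid e ω s t) := by
  obtain ⟨c, hc⟩ := (isCompact_Icc (a := s) (b := t)).exists_bound_of_continuousOn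
    (f := fun r => e - ω * r) (by fun_prop)
  refine (isCompact_Icc (a := (s, (0 : ℝ))) (b := (t, c))).of_isClosed_subset ?_ ?_
  · exact (isClosed_Icc.preimage continuous_fst).inter
      ((isClosed_le continuous_const continuous_snd).inter
        (isClosed_le continuous_snd (by fun_prop)))
  · rintro ⟨r, x⟩ ⟨hr, hx⟩
    exact ⟨⟨hr.1, hx.1⟩, hr.2, hx.2.trans ((le_abs_self _).trans (hc r hr))⟩

theorem measurableSet_trapezoid (e ω s t : ℝ) : MeasurableSet (trapezoid e ω s t) :=
  (isCompact_trapezoid e ω s t).measurableSet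

theorem trapezoid_zero (e s t : ℝ) : trapezoid e 0 s t = Icc s t ×ˢ Icc 0 e := by
  ext p
  simp only [trapezoid, zero_mul, sub_zero, mem_ofPred_eq, mem_prod]

theorem width_nonneg (hs : 0 ≤ e - ω * s) (ht : 0 ≤ e - ω * t) (hr : r ∈ Icc s t) :
    0 ≤ e - ω * r := by
  rcases le_total 0 ω with hω | hω
  · linarith [mul_le_mul_of_nonneg_left hr.2 hω]
  · linarith [mul_le_mul_of_nonpos_left hr.1 hω]

theorem indicator_trapezoid (hs : 0 ≤ e - ω * s) (ht : 0 ≤ e - ω * t) (F : ℝ → ℝ → ℝ) (r : ℝ) :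
    ∫ x, (trapezoid e ω s t).indicator (fun p => F p.1 p.2) (r, x)
      = (Icc s t).indicator (fun r => ∫ x in (0 : ℝ)..(e - ω * r), F r x) r := by
  by_cases hr : r ∈ Icc s t
  · rw [indicator_of_mem hr, intervalIntegral.integral_of_le (width_nonneg hs ht hr),
      ← integral_Icc_eq_integral_Ioc, ← integral_indicator measurableSet_Icc]
    refine integral_congr_ae (ae_of_all _ fun x => ?_)
    simp only [trapezoid, indicator, mem_ofPred_eq, hr, true_and]
    congr
  · rw [indicator_of_notMem hr, ← integral_zero ℝ ℝ (μ := volume)]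
    exact integral_congr_ae (ae_of_all _ fun x => indicator_of_notMem (fun h => hr h.1) _)

theorem intervalIntegrable_slice_trapezoid (hst : s ≤ t) (hs : 0 ≤ e - ω * s)
    (ht : 0 ≤ e - ω * t) (hF : IntegrableOn (fun p => F p.1 p.2) (trapezoid e ω s t)) :
    IntervalIntegrable (fun r => ∫ x in (0 : ℝ)..(e - ω * r), F r x) volume s t := by
  have h := hF.integrable_indicator (measurableSet_trapezoid e ω s t)
  rw [Measure.volume_eq_prod] at h
  have h' := h.integral_prod_left
  simp only [indicator_trapezoid hs ht] at h'
  rw [intervalIntegrable_iff_integrableOn_Icc_of_le hst]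
  exact (integrable_indicator_iff measurableSet_Icc).1 h'

theorem setIntegral_trapezoid (hst : s ≤ t) (hs : 0 ≤ e - ω * s) (ht : 0 ≤ e - ω * t)
    (hF : IntegrableOn (fun p => F p.1 p.2) (trapezoid e ω s t)) :
    ∫ p in trapezoid e ω s t, F p.1 p.2
      = ∫ r in s..t, ∫ x in (0 : ℝ)..(e - ω * r), F r x := by
  have h := hF.integrable_indicator (measurableSet_trapezoid e ω s t)
  rw [Measure.volume_eq_prod] at h
  rw [← integral_indicator (measurableSet_trapezoid e ω s t), Measure.volume_eq_prod,
    integral_prod _ h]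
  simp only [indicator_trapezoid hs ht]
  rw [integral_indicator measurableSet_Icc, intervalIntegral.integral_of_le hst,
    integral_Icc_eq_integral_Ioc]

end Trapezoid

/-- The time at which the line `x = b + κ r` enters a trapezoid starting at time `s`. -/
def entryTime (κ s b : ℝ) : ℝ := max s (-b / κ)

/-- The time at which the line `x = b + κ r` leaves the trapezoid `trapezoid e ω s t`, with
`k = κ + ω` the speed of the line relative to the right end. The lines with `b ≤ e - k * t` never
meet the right end; they are treated apart because `k` may vanish. -/
def exitTime (k e t b : ℝ) : ℝ := if b ≤ e - k * t then t else (e - b) / k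

section Flux

variable {κ ω e s t b r : ℝ} {Y : ℝ → ℝ → ℝ}

theorem le_exitTime_iff (hk : 0 ≤ κ + ω) (hb : b ≤ e - (κ + ω) * s) :
    r ≤ exitTime (κ + ω) e t b ↔ r ≤ t ∧ b + (κ + ω) * r ≤ e := by
  unfold exitTime
  split_ifs with h
  · exact ⟨fun hr => ⟨hr, by linarith [mul_le_mul_of_nonneg_left hr hk]⟩, And.left⟩
  · have hk' : 0 < κ + ω := hk.lt_of_ne' fun h0 => h (by rw [h0] at hb ⊢; linarith)
    rw [le_div_iff₀ hk']
    refine ⟨fun hr => ⟨le_of_not_gt fun hrt => h ?_, by linarith⟩, fun hr => by linarith⟩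
    linarith [mul_le_mul_of_nonneg_left hrt.le hk]

theorem line_mem_trapezoid_iff (hκ : 0 < κ) (hk : 0 ≤ κ + ω) (hb : b ≤ e - (κ + ω) * s) :
    (r, b + κ * r) ∈ trapezoid e ω s t
      ↔ r ∈ Icc (entryTime κ s b) (exitTime (κ + ω) e t b) := by
  have hentry : -b / κ ≤ r ↔ 0 ≤ b + κ * r := by
    rw [div_le_iff₀ hκ]
    constructor <;> intro h <;> linarith
  have hexit : b + (κ + ω) * r ≤ e ↔ b + κ * r ≤ e - ω * r := by
    constructor <;> intro h <;> linarith
  rw [mem_Icc, le_exitTime_iff hk hb, entryTime, max_le_iff, hentry, hexit]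
  exact ⟨fun h => ⟨⟨h.1.1, h.2.1⟩, h.1.2, h.2.2⟩, fun h => ⟨⟨h.1.1, h.2.1⟩, h.1.2, h.2.2⟩⟩

theorem line_notMem_trapezoid (hκ : 0 < κ) (hk : 0 ≤ κ + ω)
    (hb : b ∉ Icc (-(κ * t)) (e - (κ + ω) * s)) : (r, b + κ * r) ∉ trapezoid e ω s t := by
  rintro ⟨⟨hsr, hrt⟩, h0, he⟩
  dsimp only at hsr hrt h0 he
  refine hb ⟨?_, ?_⟩
  · linarith [mul_le_mul_of_nonneg_left hrt hκ.le]
  · linarith [mul_le_mul_of_nonneg_left hsr hk]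

theorem entryTime_le_exitTime (hκ : 0 < κ) (hk : 0 ≤ κ + ω) (hst : s ≤ t)
    (hs : 0 ≤ e - ω * s) (ht : 0 ≤ e - ω * t) (hb : b ∈ Icc (-(κ * t)) (e - (κ + ω) * s)) :
    entryTime κ s b ≤ exitTime (κ + ω) e t b := by
  rw [le_exitTime_iff hk hb.2, entryTime]
  have hdiv : κ * (-b / κ) = -b := mul_div_cancel₀ _ hκ.ne'
  have hle : -b / κ ≤ t := by rw [div_le_iff₀ hκ]; linarith [hb.1]
  refine ⟨max_le hst hle, ?_⟩
  rcases max_cases s (-b / κ) with ⟨h, -⟩ | ⟨h, hlt⟩ <;> rw [h]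
  · linarith [hb.2]
  · linarith [width_nonneg hs ht ⟨hlt.le, hle⟩]

theorem integral_flux {g : ℝ → ℝ} {k : ℝ} (c : ℝ)
    (hg : k ≠ 0 → IntervalIntegrable g volume s t) :
    IntervalIntegrable (fun b => g ((c - b) / k)) volume (c - k * t) (c - k * s) ∧
      ∫ b in (c - k * t)..(c - k * s), g ((c - b) / k) = k * ∫ r in s..t, g r := by
  rcases eq_or_ne k 0 with rfl | hk
  · simp
  have hend : ∀ r, (c - (c - k * r)) / k = r := fun r => by field_simp; ring
  constructor
  · have h := ((hg hk).symm.comp_mul_left (c := k⁻¹)).comp_sub_left c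
    simpa [div_eq_inv_mul, mul_comm] using h
  · simp only [sub_div]
    rw [intervalIntegral.integral_comp_sub_div _ hk]
    simp only [← sub_div, hend, smul_eq_mul]

theorem integral_eq_add_of_eqOn {f g h : ℝ → ℝ} {a c : ℝ} (hab : a ≤ b) (hbc : b ≤ c)
    (hf : IntervalIntegrable f volume a b) (hg : IntervalIntegrable g volume b c)
    (hfh : EqOn f h (Ioc a b)) (hgh : EqOn g h (Ioc b c)) :
    IntervalIntegrable h volume a c ∧
      ∫ x in a..c, h x = (∫ x in a..b, f x) + ∫ x in b..c, g x := by
  rw [← uIoc_of_le hab] at hfh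
  rw [← uIoc_of_le hbc] at hgh
  have hi := hf.congr hfh
  have hi' := hg.congr hgh
  refine ⟨hi.trans hi', ?_⟩
  rw [← intervalIntegral.integral_add_adjacent_intervals hi hi',
    intervalIntegral.integral_congr_ae (ae_of_all _ hfh),
    intervalIntegral.integral_congr_ae (ae_of_all _ hgh)]

theorem integral_entry (hκ : 0 < κ) (hst : s ≤ t) (hs : 0 ≤ e - ω * s)
    (hYs : IntervalIntegrable (Y s) volume 0 (e - ω * s))
    (hY0 : IntervalIntegrable (fun r => Y r 0) volume s t) :
    IntervalIntegrable (fun b => Y (entryTime κ s b) (b + κ * entryTime κ s b)) volume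
        (-(κ * t)) (e - (κ + ω) * s) ∧
      ∫ b in (-(κ * t))..(e - (κ + ω) * s), Y (entryTime κ s b) (b + κ * entryTime κ s b)
        = κ * (∫ r in s..t, Y r 0) + ∫ x in (0 : ℝ)..(e - ω * s), Y s x := by
  obtain ⟨hflux, hflux_eq⟩ := integral_flux 0 (k := κ) fun _ => hY0
  have hslice := hYs.comp_add_right (κ * s)
  have hslice_eq := intervalIntegral.integral_comp_add_right (a := -(κ * s))
    (b := e - (κ + ω) * s) (Y s) (κ * s)
  simp only [zero_sub] at hflux hflux_eq hslice
  rw [show e - ω * s - κ * s = e - (κ + ω) * s by ring] at hslice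
  rw [neg_add_cancel, show e - (κ + ω) * s + κ * s = e - ω * s by ring] at hslice_eq
  rw [← hflux_eq, ← hslice_eq]
  refine integral_eq_add_of_eqOn (by linarith [mul_le_mul_of_nonneg_left hst hκ.le])
    (by linarith) hflux hslice (fun b hb => ?_) fun b hb => ?_
  · have : entryTime κ s b = -b / κ := max_eq_right (by
      rw [le_div_iff₀ hκ]
      linarith [hb.2])
    simp only [this, mul_div_cancel₀ _ hκ.ne', add_neg_cancel]
  · have : entryTime κ s b = s := max_eq_left (by
      rw [div_le_iff₀ hκ]
      linarith [hb.1])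
    simp only [this]

theorem integral_exit (hst : s ≤ t) (hk : 0 ≤ κ + ω) (ht : 0 ≤ e - ω * t)
    (hYt : IntervalIntegrable (Y t) volume 0 (e - ω * t))
    (hYe : κ + ω ≠ 0 → IntervalIntegrable (fun r => Y r (e - ω * r)) volume s t) :
    IntervalIntegrable
        (fun b => Y (exitTime (κ + ω) e t b) (b + κ * exitTime (κ + ω) e t b)) volume
        (-(κ * t)) (e - (κ + ω) * s) ∧
      ∫ b in (-(κ * t))..(e - (κ + ω) * s),
          Y (exitTime (κ + ω) e t b) (b + κ * exitTime (κ + ω) e t b)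
        = (∫ x in (0 : ℝ)..(e - ω * t), Y t x) + (κ + ω) * ∫ r in s..t, Y r (e - ω * r) := by
  obtain ⟨hflux, hflux_eq⟩ := integral_flux e hYe
  have hslice := hYt.comp_add_right (κ * t)
  have hslice_eq := intervalIntegral.integral_comp_add_right (a := -(κ * t))
    (b := e - (κ + ω) * t) (Y t) (κ * t)
  rw [zero_sub, show e - ω * t - κ * t = e - (κ + ω) * t by ring] at hslice
  rw [neg_add_cancel, show e - (κ + ω) * t + κ * t = e - ω * t by ring] at hslice_eq
  rw [← hflux_eq, ← hslice_eq]
  refine integral_eq_add_of_eqOn (by linarith)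
    (by linarith [mul_le_mul_of_nonneg_left hst hk]) hslice hflux (fun b hb => ?_) fun b hb => ?_
  · simp only [exitTime, if_pos hb.2]
  · have hk' : κ + ω ≠ 0 := fun h0 => by
      rw [h0] at hb
      exact absurd (hb.1.trans_le hb.2) (by simp)
    have : b + κ * ((e - b) / (κ + ω)) = e - ω * ((e - b) / (κ + ω)) := by
      field_simp
      ring
    simp only [exitTime, if_neg hb.1.not_ge, this]

end Flux

/-- `Y_t + κ Y_x = F` on `S` in the sense of characteristics: along almost every line of slope `κ`
(here `Y t x`, time first), `Y` is an indefinite integral of `F` between any two points of `S`. -/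
def TransportedOn (κ : ℝ) (S : Set (ℝ × ℝ)) (Y F : ℝ → ℝ → ℝ) : Prop :=
  ∀ᵐ b : ℝ, ∀ s t, s ≤ t → (s, b + κ * s) ∈ S → (t, b + κ * t) ∈ S →
    IsPrimitive (fun r => Y r (b + κ * r)) (fun r => F r (b + κ * r)) s t

namespace TransportedOn

variable {κ : ℝ} {S S' : Set (ℝ × ℝ)} {Y F Y₁ F₁ Y₂ F₂ : ℝ → ℝ → ℝ}

theorem mono (h : TransportedOn κ S Y F) (hS : S' ⊆ S) : TransportedOn κ S' Y F := by
  filter_upwards [h] with b hb s t hst hs ht using hb s t hst (hS hs) (hS ht)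

theorem mul (h₁ : TransportedOn κ S Y₁ F₁) (h₂ : TransportedOn κ S Y₂ F₂) :
    TransportedOn κ S (fun t x => Y₁ t x * Y₂ t x)
      fun t x => F₁ t x * Y₂ t x + Y₁ t x * F₂ t x := by
  filter_upwards [h₁, h₂] with b hb₁ hb₂ s t hst hs ht
  exact (hb₁ s t hst hs ht).mul (hb₂ s t hst hs ht) hst

end TransportedOn

section TransportBalance

variable {κ ω e s t : ℝ} {Y F : ℝ → ℝ → ℝ}

theorem TransportedOn.ae_exit_sub_entry (hκ : 0 < κ) (hk : 0 ≤ κ + ω) (hst : s ≤ t)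
    (hs : 0 ≤ e - ω * s) (ht : 0 ≤ e - ω * t)
    (h : TransportedOn κ (trapezoid e ω s t) Y F) :
    ∀ᵐ b, b ∈ Icc (-(κ * t)) (e - (κ + ω) * s) →
      ∫ r in {r | (r, b + κ * r) ∈ trapezoid e ω s t}, F r (b + κ * r)
        = Y (exitTime (κ + ω) e t b) (b + κ * exitTime (κ + ω) e t b)
          - Y (entryTime κ s b) (b + κ * entryTime κ s b) := by
  filter_upwards [h] with b hb hbm
  have hle := entryTime_le_exitTime hκ hk hst hs ht hbm
  have hmem := fun r => line_mem_trapezoid_iff (r := r) (t := t) hκ hk hbm.2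
  have hprim := hb _ _ hle ((hmem _).2 (left_mem_Icc.2 hle)) ((hmem _).2 (right_mem_Icc.2 hle))
  have hset : {r | (r, b + κ * r) ∈ trapezoid e ω s t}
      = Icc (entryTime κ s b) (exitTime (κ + ω) e t b) := Set.ext hmem
  rw [hset, integral_Icc_eq_integral_Ioc, ← intervalIntegral.integral_of_le hle,
    hprim.integral_eq hle]
  ring

theorem TransportedOn.integral_balance_of_pos (hκ : 0 < κ) (hk : 0 ≤ κ + ω) (hst : s ≤ t)
    (hs : 0 ≤ e - ω * s) (ht : 0 ≤ e - ω * t)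
    (h : TransportedOn κ (trapezoid e ω s t) Y F)
    (hYs : IntervalIntegrable (Y s) volume 0 (e - ω * s))
    (hYt : IntervalIntegrable (Y t) volume 0 (e - ω * t))
    (hY0 : IntervalIntegrable (fun r => Y r 0) volume s t)
    (hYe : κ + ω ≠ 0 → IntervalIntegrable (fun r => Y r (e - ω * r)) volume s t)
    (hF : IntegrableOn (fun p => F p.1 p.2) (trapezoid e ω s t)) :
    ∫ x in (0 : ℝ)..(e - ω * t), Y t x
      = (∫ x in (0 : ℝ)..(e - ω * s), Y s x) + κ * (∫ r in s..t, Y r 0)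
        - (κ + ω) * (∫ r in s..t, Y r (e - ω * r))
        + ∫ r in s..t, ∫ x in (0 : ℝ)..(e - ω * r), F r x := by
  obtain ⟨hentry, hentry_eq⟩ := integral_entry hκ hst hs hYs hY0
  obtain ⟨hexit, hexit_eq⟩ := integral_exit hst hk ht hYt hYe
  have hle : -(κ * t) ≤ e - (κ + ω) * s := by linarith [mul_le_mul_of_nonneg_left hst hκ.le]
  have hsource : ∫ r in s..t, ∫ x in (0 : ℝ)..(e - ω * r), F r x
      = ∫ b in (-(κ * t))..(e - (κ + ω) * s),
          (Y (exitTime (κ + ω) e t b) (b + κ * exitTime (κ + ω) e t b)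
            - Y (entryTime κ s b) (b + κ * entryTime κ s b)) := by
    rw [← setIntegral_trapezoid hst hs ht hF,
      setIntegral_eq_integral_line (measurableSet_trapezoid e ω s t) hF κ,
      ← setIntegral_eq_integral_of_forall_compl_eq_zero (s := Icc (-(κ * t)) (e - (κ + ω) * s)),
      setIntegral_congr_ae measurableSet_Icc (h.ae_exit_sub_entry hκ hk hst hs ht),
      integral_Icc_eq_integral_Ioc, intervalIntegral.integral_of_le hle]
    intro b hb
    simp only [line_notMem_trapezoid hκ hk hb, ofPred_false, Measure.restrict_empty,
      integral_zero_measure]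
  rw [hsource, intervalIntegral.integral_sub hexit hentry, hentry_eq, hexit_eq]
  ring

theorem comp_neg_mem_trapezoid {p : ℝ × ℝ} :
    (-p.1, p.2) ∈ trapezoid e ω s t ↔ p ∈ trapezoid e (-ω) (-t) (-s) := by
  simp only [trapezoid, mem_ofPred_eq, mem_Icc, le_neg, neg_le, neg_mul, mul_neg,
    and_comm (a := p.1 ≤ -s)]

theorem TransportedOn.comp_neg (h : TransportedOn κ (trapezoid e ω s t) Y F) :
    TransportedOn (-κ) (trapezoid e (-ω) (-t) (-s)) (fun r => Y (-r)) fun r x => -F (-r) x := by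
  filter_upwards [h] with b hb r₁ r₂ hle h₁ h₂
  rw [← comp_neg_mem_trapezoid] at h₁ h₂
  simpa using (hb (-r₂) (-r₁) (neg_le_neg hle) (by simpa using h₂) (by simpa using h₁)).comp_neg

theorem integrableOn_comp_neg_trapezoid
    (hF : IntegrableOn (fun p => F p.1 p.2) (trapezoid e ω s t)) :
    IntegrableOn (fun p : ℝ × ℝ => -F (-p.1) p.2) (trapezoid e (-ω) (-t) (-s)) := by
  have hneg : MeasurePreserving (fun p : ℝ × ℝ => (-p.1, p.2)) volume volume :=
    (Measure.measurePreserving_neg volume).prod (MeasurePreserving.id volume)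
  have hemb : MeasurableEmbedding (fun p : ℝ × ℝ => (-p.1, p.2)) :=
    ((MeasurableEquiv.neg ℝ).prodCongr (MeasurableEquiv.refl ℝ)).measurableEmbedding
  have := ((hneg.integrableOn_comp_preimage hemb).2 hF).neg
  rwa [show (fun p : ℝ × ℝ => (-p.1, p.2)) ⁻¹' trapezoid e ω s t
    = trapezoid e (-ω) (-t) (-s) from Set.ext fun p => comp_neg_mem_trapezoid] at this

theorem TransportedOn.integral_balance_of_neg (hκ : κ < 0) (hk : κ + ω ≤ 0) (hst : s ≤ t)
    (hs : 0 ≤ e - ω * s) (ht : 0 ≤ e - ω * t)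
    (h : TransportedOn κ (trapezoid e ω s t) Y F)
    (hYs : IntervalIntegrable (Y s) volume 0 (e - ω * s))
    (hYt : IntervalIntegrable (Y t) volume 0 (e - ω * t))
    (hY0 : IntervalIntegrable (fun r => Y r 0) volume s t)
    (hYe : κ + ω ≠ 0 → IntervalIntegrable (fun r => Y r (e - ω * r)) volume s t)
    (hF : IntegrableOn (fun p => F p.1 p.2) (trapezoid e ω s t)) :
    ∫ x in (0 : ℝ)..(e - ω * t), Y t x
      = (∫ x in (0 : ℝ)..(e - ω * s), Y s x) + κ * (∫ r in s..t, Y r 0)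
        - (κ + ω) * (∫ r in s..t, Y r (e - ω * r))
        + ∫ r in s..t, ∫ x in (0 : ℝ)..(e - ω * r), F r x := by
  have reverse : ∀ {g : ℝ → ℝ}, IntervalIntegrable g volume s t →
      IntervalIntegrable (fun r => g (-r)) volume (-t) (-s) := fun hg =>
    ((IntervalIntegrable.iff_comp_neg (by finiteness)).1 hg).symm
  have key := h.comp_neg.integral_balance_of_pos (neg_pos.2 hκ) (by linarith) (neg_le_neg hst)
    (by simpa using ht) (by simpa using hs) (by simpa using hYt) (by simpa using hYs)
    (reverse hY0) (fun h0 => by simpa using reverse (hYe fun h1 => h0 (by linarith)))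
    (integrableOn_comp_neg_trapezoid hF)
  simp only [intervalIntegral.integral_neg] at key
  rw [intervalIntegral.integral_comp_neg fun r => Y r 0] at key
  simp only [neg_mul, sub_neg_eq_add, neg_neg] at key
  have hright := intervalIntegral.integral_comp_neg (a := -t) (b := -s)
    fun r => Y r (e - ω * r)
  have hsrc := intervalIntegral.integral_comp_neg (a := -t) (b := -s)
    fun r => ∫ x in (0 : ℝ)..(e - ω * r), F r x
  simp only [mul_neg, sub_neg_eq_add, neg_neg] at hright hsrc
  rw [hright, hsrc, show e + ω * -s = e - ω * s by ring,
    show e + ω * -t = e - ω * t by ring] at key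
  linear_combination -key

theorem TransportedOn.isPrimitive_integral
    (hκ : 0 < κ ∧ 0 ≤ κ + ω ∨ κ < 0 ∧ κ + ω ≤ 0) (hst : s ≤ t)
    (hs : 0 ≤ e - ω * s) (ht : 0 ≤ e - ω * t)
    (h : TransportedOn κ (trapezoid e ω s t) Y F)
    (hY : ∀ r ∈ Icc s t, IntervalIntegrable (Y r) volume 0 (e - ω * r))
    (hY0 : IntervalIntegrable (fun r => Y r 0) volume s t)
    (hYe : κ + ω ≠ 0 → IntervalIntegrable (fun r => Y r (e - ω * r)) volume s t)
    (hF : IntegrableOn (fun p => F p.1 p.2) (trapezoid e ω s t)) :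
    IsPrimitive (fun r => ∫ x in (0 : ℝ)..(e - ω * r), Y r x)
      (fun r => κ * Y r 0 - (κ + ω) * Y r (e - ω * r)
        + ∫ x in (0 : ℝ)..(e - ω * r), F r x) s t := by
  have hYe' : IntervalIntegrable (fun r => (κ + ω) * Y r (e - ω * r)) volume s t := by
    rcases eq_or_ne (κ + ω) 0 with h0 | h0
    · simp [h0]
    · exact (hYe h0).const_mul _
  have hbdry := (hY0.const_mul κ).sub hYe'
  have hsrc := intervalIntegrable_slice_trapezoid hst hs ht hF
  refine ⟨hbdry.add hsrc, fun r hr => ?_⟩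
  have hsub : uIcc s r ⊆ uIcc s t := by
    rw [uIcc_of_le hr.1, uIcc_of_le hst]
    exact Icc_subset_Icc_right hr.2
  have hS : trapezoid e ω s r ⊆ trapezoid e ω s t := fun p hp =>
    ⟨⟨hp.1.1, hp.1.2.trans hr.2⟩, hp.2⟩
  rw [intervalIntegral.integral_add (hbdry.mono_set hsub) (hsrc.mono_set hsub),
    intervalIntegral.integral_sub ((hY0.const_mul κ).mono_set hsub) (hYe'.mono_set hsub),
    intervalIntegral.integral_const_mul, intervalIntegral.integral_const_mul]
  have hr0 := width_nonneg hs ht hr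
  have hYe'' := fun h0 => (hYe h0).mono_set hsub
  have balance := hκ.elim
    (fun h' => (h.mono hS).integral_balance_of_pos h'.1 h'.2 hr.1 hs hr0
      (hY s (left_mem_Icc.2 hst)) (hY r hr) (hY0.mono_set hsub) hYe'' (hF.mono_set hS))
    (fun h' => (h.mono hS).integral_balance_of_neg h'.1 h'.2 hr.1 hs hr0
      (hY s (left_mem_Icc.2 hst)) (hY r hr) (hY0.mono_set hsub) hYe'' (hF.mono_set hS))
  linear_combination balance

end TransportBalance

theorem line_mem_trapezoid {e ω s t κ b s' t' r : ℝ} (hs : (s', b + κ * s') ∈ trapezoid e ω s t)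
    (ht : (t', b + κ * t') ∈ trapezoid e ω s t) (hr : r ∈ Icc s' t') :
    (r, b + κ * r) ∈ trapezoid e ω s t := by
  obtain ⟨⟨hs₁, -⟩, hs₃, hs₄⟩ := hs
  obtain ⟨⟨-, ht₂⟩, ht₃, ht₄⟩ := ht
  refine ⟨⟨hs₁.trans hr.1, hr.2.trans ht₂⟩, ?_, ?_⟩
  · have := width_nonneg (e := b) (ω := -κ) (by linarith) (by linarith) hr
    linarith
  · have := width_nonneg (e := e - b) (ω := ω + κ) (by linarith) (by linarith) hr
    linarith

section Triangle

variable {L : ℝ}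

theorem convex_triangle (L : ℝ) : Convex ℝ (triangle L) := by
  rintro ⟨x, y⟩ ⟨h1, h2, h3⟩ ⟨x', y'⟩ ⟨h1', h2', h3'⟩ a b ha hb hab
  simp only [triangle, mem_ofPred_eq, Prod.smul_mk, Prod.mk_add_mk, smul_eq_mul] at *
  refine ⟨by positivity, by gcongr, ?_⟩
  calc a * x + b * x' ≤ a * L + b * L := by gcongr
    _ = L := by rw [← add_mul, hab, one_mul]

theorem isClosed_triangle (L : ℝ) : IsClosed (triangle L) :=
  (isClosed_le continuous_const continuous_snd).inter
    ((isClosed_le continuous_snd continuous_fst).inter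
      (isClosed_le continuous_fst continuous_const))

theorem isCompact_triangle (L : ℝ) : IsCompact (triangle L) := by
  refine (isCompact_Icc (a := ((0 : ℝ), (0 : ℝ))) (b := (L, L))).of_isClosed_subset
    (isClosed_triangle L) ?_
  rintro ⟨x, y⟩ ⟨h1, h2, h3⟩
  exact ⟨⟨h1.trans h2, h1⟩, ⟨h3, h2.trans h3⟩⟩

theorem uniqueDiffOn_triangle (hL : 0 < L) : UniqueDiffOn ℝ (triangle L) := by
  refine uniqueDiffOn_convex (convex_triangle L) ⟨((L / 2, L / 4) : ℝ × ℝ), ?_⟩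
  refine interior_mono (s := {p : ℝ × ℝ | 0 < p.2 ∧ p.2 < p.1 ∧ p.1 < L})
    (t := triangle L) (fun p hp => And.intro hp.1.le ⟨hp.2.1.le, hp.2.2.le⟩) ?_
  have ho : IsOpen {p : ℝ × ℝ | 0 < p.2 ∧ p.2 < p.1 ∧ p.1 < L} :=
    (isOpen_lt continuous_const continuous_snd).inter
      ((isOpen_lt continuous_snd continuous_fst).inter
        (isOpen_lt continuous_fst continuous_const))
  rw [ho.interior_eq]
  exact ⟨by positivity, by change L / 4 < L / 2; linarith, by change L / 2 < L; linarith⟩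

theorem exists_continuous_eqOn_triangle (hL : 0 ≤ L) {f : ℝ × ℝ → ℝ}
    (hf : ContinuousOn f (triangle L)) :
    ∃ f' : ℝ × ℝ → ℝ, Continuous f' ∧ EqOn f f' (triangle L) := by
  let π : ℝ × ℝ → ℝ × ℝ := fun p => (max 0 (min p.1 L), max 0 (min p.2 (max 0 (min p.1 L))))
  have hπ : Continuous π := by fun_prop
  have hm : ∀ p, π p ∈ triangle L := fun p =>
    ⟨le_max_left _ _, max_le (le_max_left _ _) (min_le_right _ _), max_le hL (min_le_right _ _)⟩
  refine ⟨f ∘ π, hf.comp_continuous hπ hm, ?_⟩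
  rintro ⟨x, y⟩ ⟨h1, h2, h3⟩
  simp only at h1 h2 h3
  have : π (x, y) = (x, y) := by
    simp [π, h1, h2, h3, h1.trans h2]
  simp [this]

theorem continuousOn_fderivWithin_triangle (hL : 0 < L) {f : ℝ × ℝ → ℝ}
    (hf : ContDiffOn ℝ 1 f (triangle L)) (e : ℝ × ℝ) :
    ContinuousOn (fun p => fderivWithin ℝ f (triangle L) p e) (triangle L) :=
  (hf.continuousOn_fderivWithin (uniqueDiffOn_triangle hL) le_rfl).clm_apply continuousOn_const

theorem isPrimitive_comp_triangle (hL : 0 < L) {k : ℝ × ℝ → ℝ}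
    (hk : ContDiffOn ℝ 1 k (triangle L)) {p : ℝ → ℝ × ℝ} {q : ℝ × ℝ} {s t : ℝ} (hst : s ≤ t)
    (hp : ∀ r, HasDerivAt p q r) (hm : MapsTo p (Icc s t) (triangle L)) :
    IsPrimitive (fun r => k (p r)) (fun r => fderivWithin ℝ k (triangle L) (p r) q) s t :=
  .of_hasDerivWithinAt hst
    ((continuousOn_fderivWithin_triangle hL hk q).comp
      (HasDerivAt.continuousOn fun r _ => hp r) hm)
    fun r hr => (hk.differentiableOn one_ne_zero _ (hm hr)).hasFDerivWithinAt.comp_hasDerivWithinAt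
      r (hp r).hasDerivWithinAt hm

theorem mk_mem_triangle_of_mem_trapezoid {e ω s t : ℝ} (he : ∀ r ∈ Icc s t, e - ω * r ≤ L)
    {p : ℝ × ℝ} (hp : p ∈ trapezoid e ω s t) : (e - ω * p.1, p.2) ∈ triangle L :=
  ⟨hp.2.1, hp.2.2, he _ hp.1⟩

theorem transportedOn_triangle (hL : 0 < L) {k : ℝ × ℝ → ℝ}
    (hk : ContDiffOn ℝ 1 k (triangle L)) {e ω s t : ℝ} (κ : ℝ)
    (he : ∀ r ∈ Icc s t, e - ω * r ≤ L) :
    TransportedOn κ (trapezoid e ω s t) (fun r x => k (e - ω * r, x))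
      fun r x => fderivWithin ℝ k (triangle L) (e - ω * r, x) (-ω, κ) := by
  refine ae_of_all _ fun b s' t' hst hs ht => isPrimitive_comp_triangle
    (p := fun r => (e - ω * r, b + κ * r)) hL hk hst (fun r => ?_) fun r hr => ?_
  · have h₁ : HasDerivAt (fun r => e - ω * r) (-ω) r := by
      simpa using ((hasDerivAt_id r).const_mul ω).const_sub e
    have h₂ : HasDerivAt (fun r => b + κ * r) κ r := by
      simpa using ((hasDerivAt_id r).const_mul κ).const_add b
    exact h₁.prodMk h₂
  · have hseg : (r, b + κ * r) ∈ trapezoid e ω s t :=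
      line_mem_trapezoid hs ht hr
    exact mk_mem_triangle_of_mem_trapezoid he hseg

theorem fderivWithin_triangle_apply (k : ℝ × ℝ → ℝ) (p : ℝ × ℝ) (a b : ℝ) :
    fderivWithin ℝ k (triangle L) p (a, b) = a * fderivWithin ℝ k (triangle L) p (1, 0)
      + b * fderivWithin ℝ k (triangle L) p (0, 1) := by
  have : ((a, b) : ℝ × ℝ) = a • (1, 0) + b • (0, 1) := by simp
  rw [this, map_add, map_smul, map_smul, smul_eq_mul, smul_eq_mul]

end Triangle

theorem memLp_continuousOn_mul {X : Type*} [TopologicalSpace X] [MeasurableSpace X]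
    [OpensMeasurableSpace X] {μ : Measure X} {p : ENNReal} {k g : X → ℝ} {S C : Set X}
    (hk : ContinuousOn k C) (hg : MemLp g p (μ.restrict S)) (hC : IsCompact C)
    (hS : MeasurableSet S) (hSC : S ⊆ C) :
    MemLp (fun x => k x * g x) p (μ.restrict S) := by
  obtain ⟨c, hc⟩ := hC.exists_bound_of_continuousOn hk
  exact hg.mul' (memLp_top_of_bound ((hk.mono hSC).aestronglyMeasurable hS) c
    (ae_restrict_of_forall_mem hS fun x hx => hc x (hSC hx)))

theorem memLp_two_of_intervalIntegrable_sq {y : ℝ → ℝ} {a b : ℝ} (hab : a ≤ b)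
    (hm : Measurable y) (h : IntervalIntegrable (fun r => y r ^ 2) volume a b) :
    MemLp y 2 (volume.restrict (Ioc a b)) :=
  (memLp_two_iff_integrable_sq hm.aestronglyMeasurable).2
    ((intervalIntegrable_iff_integrableOn_Ioc_of_le hab).1 h)

theorem intervalIntegrable_of_memLp {y : ℝ → ℝ} {p : ENNReal} (hp : 1 ≤ p) {a b c d : ℝ}
    (hy : MemLp y p (volume.restrict (Ioc a b))) (hac : a ≤ c) (hcd : c ≤ d) (hdb : d ≤ b) :
    IntervalIntegrable y volume c d :=
  (intervalIntegrable_iff_integrableOn_Ioc_of_le hcd).2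
    (IntegrableOn.mono_set (hy.integrable hp) (Ioc_subset_Ioc hac hdb))

theorem isFiniteMeasure_restrict_rect (τ L : ℝ) :
    IsFiniteMeasure ((volume : Measure (ℝ × ℝ)).restrict (Icc 0 τ ×ˢ Icc 0 L)) :=
  isFiniteMeasure_restrict.2 (isCompact_Icc.prod isCompact_Icc).measure_lt_top.ne

theorem memLp_rect {τ L C : ℝ} (hL : 0 ≤ L) {y : ℝ → ℝ → ℝ}
    (hm : Measurable (fun p : ℝ × ℝ => y p.1 p.2))
    (hs : ∀ t ∈ Icc 0 τ, MemLp (y t) 2 (volume.restrict (Ioc 0 L)))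
    (hC : ∀ t ∈ Icc 0 τ, ∫ x in (0 : ℝ)..L, y t x ^ 2 ≤ C) :
    MemLp (fun p : ℝ × ℝ => y p.1 p.2) 2 (volume.restrict (Icc 0 τ ×ˢ Icc 0 L)) := by
  rw [memLp_two_iff_integrable_sq hm.aestronglyMeasurable, Measure.volume_eq_prod,
    ← Measure.prod_restrict,
    Measure.restrict_congr_set (Ioc_ae_eq_Icc (a := (0 : ℝ)) (b := L)).symm,
    integrable_prod_iff (hm.pow_const 2).aestronglyMeasurable]
  refine ⟨?_, Measure.integrableOn_of_bounded (M := C) (by simp) ?_ ?_⟩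
  · filter_upwards [ae_restrict_mem measurableSet_Icc] with t ht
    exact (hs t ht).integrable_sq
  · exact (hm.pow_const 2).norm.stronglyMeasurable.integral_prod_right'.aestronglyMeasurable
  · filter_upwards [ae_restrict_mem measurableSet_Icc] with t ht
    have hCt := hC t ht
    rw [intervalIntegral.integral_of_le hL] at hCt
    simp only [norm_pow, Real.norm_eq_abs, sq_abs]
    rwa [abs_of_nonneg (integral_nonneg fun x => by positivity)]

section Profile

variable {L C x : ℝ} {a a' : ℝ → Fin 3 → ℝ} {b b' : ℝ → ℝ}

theorem InL2.integrableOn_sq (h : InL2 L a b) :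
    IntegrableOn (fun x => (∑ i, a x i ^ 2) + b x ^ 2) (Ioc 0 L) :=
  (integrable_finsetSum _ fun i _ => (h.1 i).integrable_sq).add h.2.integrable_sq

theorem normSq_nonneg (hL : 0 ≤ L) (a : ℝ → Fin 3 → ℝ) (b : ℝ → ℝ) : 0 ≤ normSq L a b :=
  intervalIntegral.integral_nonneg hL fun x _ => by positivity

theorem InL2.integral_fst_sq_le (h : InL2 L a b) (hL : 0 ≤ L) (i : Fin 3) :
    ∫ x in (0 : ℝ)..L, a x i ^ 2 ≤ normSq L a b := by
  simp only [normSq, intervalIntegral.integral_of_le hL]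
  refine integral_mono (h.1 i).integrable_sq h.integrableOn_sq fun x => ?_
  exact (Finset.single_le_sum (f := fun i => a x i ^ 2) (fun j _ => sq_nonneg _)
    (Finset.mem_univ i)).trans (le_add_of_nonneg_right (sq_nonneg _))

theorem InL2.integral_snd_sq_le (h : InL2 L a b) (hL : 0 ≤ L) :
    ∫ x in (0 : ℝ)..L, b x ^ 2 ≤ normSq L a b := by
  simp only [normSq, intervalIntegral.integral_of_le hL]
  exact integral_mono h.2.integrable_sq h.integrableOn_sq fun x =>
    le_add_of_nonneg_left (Finset.sum_nonneg fun i _ => sq_nonneg _)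

theorem normSq_le_two_mul_add (hL : 0 ≤ L) (h : InL2 L a b) (h' : InL2 L a' b') :
    normSq L a b ≤ 2 * (normSq L (a - a') (b - b') + normSq L a' b') := by
  have hd : InL2 L (a - a') (b - b') := ⟨fun i => (h.1 i).sub (h'.1 i), h.2.sub h'.2⟩
  simp only [normSq, intervalIntegral.integral_of_le hL]
  rw [← integral_add hd.integrableOn_sq h'.integrableOn_sq, ← integral_const_mul]
  refine integral_mono h.integrableOn_sq ((hd.integrableOn_sq.add
    h'.integrableOn_sq).const_mul 2) fun x => ?_
  have hsq (y z : ℝ) : y ^ 2 ≤ 2 * ((y - z) ^ 2 + z ^ 2) := by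
    simpa only [sub_add_cancel] using add_sq_le (a := y - z) (b := z)
  simp only [Fin.sum_univ_three, Pi.sub_apply]
  linarith [hsq (a x 0) (a' x 0), hsq (a x 1) (a' x 1), hsq (a x 2) (a' x 2), hsq (b x) (b' x)]

theorem abs_mul_le_mul_one_add_sq {k y : ℝ} (hk : |k| ≤ C) : |k * y| ≤ C * (1 + y ^ 2) := by
  have hy : |y| ≤ 1 + y ^ 2 := abs_le.2 ⟨by nlinarith [sq_nonneg (y + 1)],
    by nlinarith [sq_nonneg (y - 1)]⟩
  rw [abs_mul]
  exact mul_le_mul hk hy (abs_nonneg y) ((abs_nonneg k).trans hk)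

variable {K : Fin 3 → ℝ × ℝ → ℝ} {M : ℝ × ℝ → ℝ}

theorem abs_volterra_integrand_le {p : ℝ × ℝ} (hK : ∀ i, |K i p| ≤ C) (hM : |M p| ≤ C)
    (ξ : ℝ) : |(∑ i, K i p * a ξ i) + M p * b ξ| ≤ C * (4 + ((∑ i, a ξ i ^ 2) + b ξ ^ 2)) :=
  calc |(∑ i, K i p * a ξ i) + M p * b ξ| ≤ (∑ i, |K i p * a ξ i|) + |M p * b ξ| :=
        (abs_add_le _ _).trans (add_le_add_left (Finset.abs_sum_le_sum_abs _ _) _)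
    _ ≤ (∑ i, C * (1 + a ξ i ^ 2)) + C * (1 + b ξ ^ 2) :=
        add_le_add (Finset.sum_le_sum fun i _ => abs_mul_le_mul_one_add_sq (hK i))
          (abs_mul_le_mul_one_add_sq hM)
    _ = C * (4 + ((∑ i, a ξ i ^ 2) + b ξ ^ 2)) := by
        simp only [Fin.sum_univ_three]
        ring

theorem abs_volterra_le (hK : ∀ i, ∀ p ∈ triangle L, |K i p| ≤ C)
    (hM : ∀ p ∈ triangle L, |M p| ≤ C) (h : InL2 L a b) (hx : x ∈ Icc 0 L) :
    |volterra K M a b x| ≤ C * (4 * L + normSq L a b) := by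
  have hL : 0 ≤ L := hx.1.trans hx.2
  have hC : 0 ≤ C := (abs_nonneg _).trans (hM (0, 0) ⟨le_rfl, le_rfl, hL⟩)
  have hint : IntervalIntegrable (fun ξ => (∑ i, a ξ i ^ 2) + b ξ ^ 2) volume 0 L :=
    (intervalIntegrable_iff_integrableOn_Ioc_of_le hL).2 h.integrableOn_sq
  have hint' : IntervalIntegrable (fun ξ => C * (4 + ((∑ i, a ξ i ^ 2) + b ξ ^ 2))) volume 0 L :=
    (intervalIntegrable_const.add hint).const_mul C
  calc |volterra K M a b x|
      ≤ ∫ ξ in (0 : ℝ)..x, C * (4 + ((∑ i, a ξ i ^ 2) + b ξ ^ 2)) := by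
        rw [volterra, ← Real.norm_eq_abs]
        refine intervalIntegral.norm_integral_le_of_norm_le hx.1 (ae_of_all _ fun ξ hξ => ?_)
          (hint'.mono_set (uIcc_subset_uIcc left_mem_uIcc (uIcc_of_le hL ▸ hx)))
        have hm : (x, ξ) ∈ triangle L := ⟨hξ.1.le, hξ.2, hx.2⟩
        exact abs_volterra_integrand_le (fun i => hK i _ hm) (hM _ hm) ξ
    _ ≤ ∫ ξ in (0 : ℝ)..L, C * (4 + ((∑ i, a ξ i ^ 2) + b ξ ^ 2)) :=
        intervalIntegral.integral_mono_interval le_rfl hx.1 hx.2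
          (ae_of_all _ fun ξ => by simp only [Pi.zero_apply]; positivity) hint'
    _ = C * (4 * L + normSq L a b) := by
        rw [intervalIntegral.integral_const_mul,
          intervalIntegral.integral_add intervalIntegrable_const hint,
          intervalIntegral.integral_const, sub_zero, smul_eq_mul, normSq, mul_comm L]

theorem exists_abs_kernel_le (hK : ∀ i, ContinuousOn (K i) (triangle L))
    (hM : ContinuousOn M (triangle L)) :
    ∃ C, (∀ i, ∀ p ∈ triangle L, |K i p| ≤ C) ∧ ∀ p ∈ triangle L, |M p| ≤ C := by
  obtain ⟨C, hC⟩ := (isCompact_triangle L).exists_bound_of_continuousOn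
    (f := fun p => (∑ i, |K i p|) + |M p|)
    ((continuousOn_finsetSum _ fun i _ => (hK i).abs).add hM.abs)
  have hsum : ∀ p ∈ triangle L, (∑ i, |K i p|) + |M p| ≤ C := fun p hp =>
    (le_abs_self _).trans (hC p hp)
  refine ⟨C, fun i p hp => ?_, fun p hp => ?_⟩
  · exact (Finset.single_le_sum (fun j _ => abs_nonneg (K j p)) (Finset.mem_univ i)).trans
      ((le_add_of_nonneg_right (abs_nonneg _)).trans (hsum p hp))
  · exact (le_add_of_nonneg_left (Finset.sum_nonneg fun j _ => abs_nonneg _)).trans (hsum p hp)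

variable {u : ℝ → ℝ → Fin 3 → ℝ} {v : ℝ → ℝ → ℝ}

theorem exists_measurable_volterra (hL : 0 ≤ L) (hK : ∀ i, ContinuousOn (K i) (triangle L))
    (hM : ContinuousOn M (triangle L)) (hu : ∀ i, Measurable (fun p : ℝ × ℝ => u p.1 p.2 i))
    (hv : Measurable (fun p : ℝ × ℝ => v p.1 p.2)) :
    ∃ Φ : ℝ × ℝ → ℝ, Measurable Φ ∧
      ∀ t, ∀ x ∈ Icc 0 L, volterra K M (u t) (v t) x = Φ (t, x) := by
  choose K' hK' hKe using fun i => exists_continuous_eqOn_triangle hL (hK i)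
  obtain ⟨M', hM', hMe⟩ := exists_continuous_eqOn_triangle hL hM
  let S : Set ((ℝ × ℝ) × ℝ) := {q | q.2 ∈ Ioc 0 q.1.2}
  let f : (ℝ × ℝ) × ℝ → ℝ := S.indicator fun q =>
    (∑ i, K' i (q.1.2, q.2) * u q.1.1 q.2 i) + M' (q.1.2, q.2) * v q.1.1 q.2
  have hf : Measurable f := by
    refine Measurable.indicator ?_ ((measurableSet_lt measurable_const measurable_snd).inter
      (measurableSet_le measurable_snd (by fun_prop)))
    have hp : Measurable fun q : (ℝ × ℝ) × ℝ => (q.1.1, q.2) := by fun_prop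
    have hq : Measurable fun q : (ℝ × ℝ) × ℝ => (q.1.2, q.2) := by fun_prop
    exact (Finset.measurable_sum _ fun i _ =>
      ((hK' i).measurable.comp hq).mul ((hu i).comp hp)).add
      ((hM'.measurable.comp hq).mul (hv.comp hp))
  refine ⟨fun p => ∫ ξ, f (p, ξ), hf.stronglyMeasurable.integral_prod_right'.measurable,
    fun t x hx => ?_⟩
  rw [volterra, intervalIntegral.integral_of_le hx.1, ← integral_indicator measurableSet_Ioc]
  refine integral_congr_ae (ae_of_all _ fun ξ => ?_)
  by_cases hξ : ξ ∈ Ioc 0 x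
  · have hm : (x, ξ) ∈ triangle L := ⟨hξ.1.le, hξ.2, hx.2⟩
    have hS : ((t, x), ξ) ∈ S := hξ
    simp only [f, indicator_of_mem hξ, indicator_of_mem hS, hMe hm, fun i => hKe i hm]
  · have hS : ((t, x), ξ) ∉ S := hξ
    simp only [f, indicator_of_notMem hξ, indicator_of_notMem hS]

end Profile

/-- `y_t + κ y_x = f` on `[0, τ] × [0, L]` in the sense of characteristics, with the square
integrability that is needed to test the equation against `y` itself and against a moving kernel:
of `y` and `f` on the rectangle, of `y` at every time, and of the boundary traces of `y`. -/
structure IsTransportSolution (κ L τ : ℝ) (y f : ℝ → ℝ → ℝ) : Prop where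
  memLp : MemLp (fun p : ℝ × ℝ => y p.1 p.2) 2 (volume.restrict (Icc 0 τ ×ˢ Icc 0 L))
  memLp_source : MemLp (fun p : ℝ × ℝ => f p.1 p.2) 2 (volume.restrict (Icc 0 τ ×ˢ Icc 0 L))
  memLp_slice : ∀ r ∈ Icc 0 τ, MemLp (y r) 2 (volume.restrict (Ioc 0 L))
  memLp_left : MemLp (fun r => y r 0) 2 (volume.restrict (Ioc 0 τ))
  memLp_right : MemLp (fun r => y r L) 2 (volume.restrict (Ioc 0 τ))
  transported : TransportedOn κ (Icc 0 τ ×ˢ Icc 0 L) y f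

theorem transportedOn_of_hasDerivAt {φ φ' : ℝ → ℝ} (hφ : ∀ x, HasDerivAt φ (φ' x) x)
    (hφ' : Continuous φ') (κ : ℝ) (S : Set (ℝ × ℝ)) :
    TransportedOn κ S (fun _ x => φ x) fun _ x => κ * φ' x := by
  refine ae_of_all _ fun b s t hst _ _ => .of_hasDerivWithinAt hst (by fun_prop) fun r _ => ?_
  have hline : HasDerivAt (fun r => b + κ * r) κ r := by
    simpa using ((hasDerivAt_id r).const_mul κ).const_add b
  exact ((hφ _).comp r hline).hasDerivWithinAt.congr_deriv (mul_comm _ _)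

theorem intervalIntegrable_kernel_mul {L e : ℝ} (he : e ∈ Icc 0 L) {k : ℝ × ℝ → ℝ}
    (hk : ContinuousOn k (triangle L)) {y : ℝ → ℝ} (hy : MemLp y 2 (volume.restrict (Ioc 0 L))) :
    IntervalIntegrable (fun x => k (e, x) * y x) volume 0 e :=
  (intervalIntegrable_of_memLp one_le_two hy le_rfl he.1 he.2).continuousOn_mul <|
    hk.comp (by fun_prop) fun x hx => by
      rw [uIcc_of_le he.1] at hx
      exact ⟨hx.1, hx.2, he.2⟩

/-- The time derivative of `∫₀ᵉ k(e, x) y(x) dx` when `y_t + κ y_x = f` and the point `e` moves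
with velocity `-ω`. -/
def kernelRate (L κ ω : ℝ) (k : ℝ × ℝ → ℝ) (y f : ℝ → ℝ) (e : ℝ) : ℝ :=
  κ * (k (e, 0) * y 0) - (κ + ω) * (k (e, e) * y e)
    + ∫ x in (0 : ℝ)..e,
      (fderivWithin ℝ k (triangle L) (e, x) (-ω, κ) * y x + k (e, x) * f x)

namespace IsTransportSolution

variable {κ L τ : ℝ} {y f : ℝ → ℝ → ℝ}

theorem integrableOn (h : IsTransportSolution κ L τ y f) :
    IntegrableOn (fun p : ℝ × ℝ => y p.1 p.2) (Icc 0 τ ×ˢ Icc 0 L) :=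
  have := isFiniteMeasure_restrict_rect τ L
  h.memLp.integrable one_le_two

theorem integrableOn_source (h : IsTransportSolution κ L τ y f) :
    IntegrableOn (fun p : ℝ × ℝ => f p.1 p.2) (Icc 0 τ ×ˢ Icc 0 L) :=
  have := isFiniteMeasure_restrict_rect τ L
  h.memLp_source.integrable one_le_two

theorem isPrimitive_energy (h : IsTransportSolution κ L τ y f) (hκ : κ ≠ 0) (hτ : 0 ≤ τ)
    (hL : 0 ≤ L) {φ φ' : ℝ → ℝ} (hφ : ∀ x, HasDerivAt φ (φ' x) x) (hφ' : Continuous φ') :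
    IsPrimitive (fun r => ∫ x in (0 : ℝ)..L, φ x * y r x ^ 2)
      (fun r => κ * (φ 0 * y r 0 ^ 2) - κ * (φ L * y r L ^ 2)
        + ∫ x in (0 : ℝ)..L, (κ * φ' x * y r x ^ 2 + 2 * φ x * (y r x * f r x))) 0 τ := by
  have hφc : Continuous φ := continuous_iff_continuousAt.2 fun x => (hφ x).continuousAt
  have hrect : IsCompact (Icc (0 : ℝ) τ ×ˢ Icc (0 : ℝ) L) := isCompact_Icc.prod isCompact_Icc
  have htransported : TransportedOn κ (Icc 0 τ ×ˢ Icc 0 L) (fun r x => φ x * y r x ^ 2)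
      fun r x => κ * φ' x * y r x ^ 2 + 2 * φ x * (y r x * f r x) := by
    convert (transportedOn_of_hasDerivAt hφ hφ' κ _).mul (h.transported.mul h.transported)
      using 3 <;> ring
  have hrate : IntegrableOn (fun p : ℝ × ℝ => κ * φ' p.2 * y p.1 p.2 ^ 2
      + 2 * φ p.2 * (y p.1 p.2 * f p.1 p.2)) (Icc 0 τ ×ˢ Icc 0 L) :=
    (IntegrableOn.continuousOn_mul (by fun_prop) h.memLp.integrable_sq hrect).add
      (IntegrableOn.continuousOn_mul (by fun_prop) (h.memLp.integrable_mul h.memLp_source) hrect)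
  have hslice : ∀ r ∈ Icc 0 τ, IntervalIntegrable (fun x => φ x * y r x ^ 2) volume 0 L :=
    fun r hr => ((intervalIntegrable_iff_integrableOn_Ioc_of_le hL).2
      (h.memLp_slice r hr).integrable_sq).continuousOn_mul hφc.continuousOn
  have hleft := (intervalIntegrable_iff_integrableOn_Ioc_of_le hτ).2 h.memLp_left.integrable_sq
  have hright := (intervalIntegrable_iff_integrableOn_Ioc_of_le hτ).2 h.memLp_right.integrable_sq
  have := TransportedOn.isPrimitive_integral (e := L) (ω := 0)
    (Y := fun r x => φ x * y r x ^ 2)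
    (F := fun r x => κ * φ' x * y r x ^ 2 + 2 * φ x * (y r x * f r x))
    (by rcases hκ.lt_or_gt with hκ | hκ <;> simp [hκ, hκ.le]) hτ (by simpa) (by simpa)
    (trapezoid_zero L 0 τ ▸ htransported) (by simpa using hslice) (hleft.const_mul (φ 0))
    (fun _ => by simpa using hright.const_mul (φ L)) (trapezoid_zero L 0 τ ▸ hrate)
  simpa only [zero_mul, sub_zero, add_zero] using this

theorem isPrimitive_integral_kernel (h : IsTransportSolution κ L τ y f) (hL : 0 < L)
    {ω e s t : ℝ} (hκ : 0 < κ ∧ 0 ≤ κ + ω ∨ κ < 0 ∧ κ + ω ≤ 0) (hs : 0 ≤ s) (hst : s ≤ t)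
    (ht : t ≤ τ) (he : ∀ r ∈ Icc s t, e - ω * r ∈ Icc 0 L) {k : ℝ × ℝ → ℝ}
    (hk : ContDiffOn ℝ 1 k (triangle L))
    (hye : κ + ω ≠ 0 → IntervalIntegrable (fun r => y r (e - ω * r)) volume s t) :
    IsPrimitive (fun r => ∫ x in (0 : ℝ)..(e - ω * r), k (e - ω * r, x) * y r x)
      (fun r => kernelRate L κ ω k (y r) (f r) (e - ω * r)) s t := by
  have heL := fun r hr => (he r hr).2
  have hsub : trapezoid e ω s t ⊆ Icc 0 τ ×ˢ Icc 0 L := fun p hp =>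
    ⟨⟨hs.trans hp.1.1, hp.1.2.trans ht⟩, hp.2.1, hp.2.2.trans (heL _ hp.1)⟩
  have hcpt := isCompact_trapezoid e ω s t
  have hmaps : MapsTo (fun p : ℝ × ℝ => (e - ω * p.1, p.2)) (trapezoid e ω s t) (triangle L) :=
    fun p hp => mk_mem_triangle_of_mem_trapezoid heL hp
  have hrate : IntegrableOn (fun p : ℝ × ℝ =>
      fderivWithin ℝ k (triangle L) (e - ω * p.1, p.2) (-ω, κ) * y p.1 p.2
        + k (e - ω * p.1, p.2) * f p.1 p.2) (trapezoid e ω s t) :=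
    (IntegrableOn.continuousOn_mul ((continuousOn_fderivWithin_triangle hL hk _).comp
      (by fun_prop) hmaps) (h.integrableOn.mono_set hsub) hcpt).add
      (IntegrableOn.continuousOn_mul (hk.continuousOn.comp (by fun_prop) hmaps)
        (h.integrableOn_source.mono_set hsub) hcpt)
  have hτ : ∀ r ∈ Icc s t, r ∈ Icc 0 τ := fun r hr => ⟨hs.trans hr.1, hr.2.trans ht⟩
  have hslice : ∀ r ∈ Icc s t,
      IntervalIntegrable (fun x => k (e - ω * r, x) * y r x) volume 0 (e - ω * r) := fun r hr =>
    intervalIntegrable_kernel_mul (he r hr) hk.continuousOn (h.memLp_slice r (hτ r hr))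
  have hedge : ∀ {q z : ℝ → ℝ}, ContinuousOn q (Icc s t) →
      (∀ r ∈ Icc s t, (e - ω * r, q r) ∈ triangle L) → IntervalIntegrable z volume s t →
      IntervalIntegrable (fun r => k (e - ω * r, q r) * z r) volume s t := fun hq hqm hz =>
    hz.continuousOn_mul (uIcc_of_le hst ▸
      hk.continuousOn.comp (ContinuousOn.prodMk (by fun_prop) hq) hqm)
  exact TransportedOn.isPrimitive_integral hκ hst (he s (left_mem_Icc.2 hst)).1
    (he t (right_mem_Icc.2 hst)).1
    ((transportedOn_triangle hL hk κ heL).mul (h.transported.mono hsub)) hslice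
    (hedge continuousOn_const (fun r hr => ⟨le_rfl, (he r hr).1, (he r hr).2⟩)
      (intervalIntegrable_of_memLp one_le_two h.memLp_left hs hst ht))
    (fun hne => hedge (by fun_prop) (fun r hr => ⟨(he r hr).1, le_rfl, (he r hr).2⟩) (hye hne))
    hrate

end IsTransportSolution

/-- The source term of the `i`-th rightgoing component at the profile `(a, b)`, namely
`(Σ⁺⁺ a + Σ⁺⁻ b)_i`. -/
def sourcePlus (P : Plant) (a : ℝ → Fin 3 → ℝ) (b : ℝ → ℝ) (i : Fin 3) (x : ℝ) : ℝ :=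
  (∑ j, P.Spp x i j * a x j) + P.Spm x i * b x

/-- The source term `Σ⁻⁺ a` of the leftgoing component at a profile with rightgoing part `a`. -/
def sourceMinus (P : Plant) (a : ℝ → Fin 3 → ℝ) (x : ℝ) : ℝ := ∑ j, P.Smp x j * a x j

theorem memLp_slice_mul {L : ℝ} {k g : ℝ → ℝ} (hk : ContinuousOn k (Icc 0 L))
    (hg : MemLp g 2 (volume.restrict (Ioc 0 L))) :
    MemLp (fun x => k x * g x) 2 (volume.restrict (Ioc 0 L)) :=
  memLp_continuousOn_mul hk hg isCompact_Icc measurableSet_Ioc Ioc_subset_Icc_self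

theorem memLp_rect_mul {τ L : ℝ} {k : ℝ → ℝ} (hk : ContinuousOn k (Icc 0 L)) {g : ℝ × ℝ → ℝ}
    (hg : MemLp g 2 (volume.restrict (Icc 0 τ ×ˢ Icc 0 L))) :
    MemLp (fun p : ℝ × ℝ => k p.2 * g p) 2 (volume.restrict (Icc 0 τ ×ˢ Icc 0 L)) :=
  memLp_continuousOn_mul (k := fun p : ℝ × ℝ => k p.2)
    (hk.comp continuousOn_snd fun _ hp => hp.2) hg (isCompact_Icc.prod isCompact_Icc)
    (measurableSet_Icc.prod measurableSet_Icc) Subset.rfl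

theorem InL2.memLp_sourcePlus {P : Plant} {a : ℝ → Fin 3 → ℝ} {b : ℝ → ℝ} (h : InL2 P.L a b)
    (i : Fin 3) : MemLp (sourcePlus P a b i) 2 (volume.restrict (Ioc 0 P.L)) :=
  (memLp_finsetSum _ fun j _ => memLp_slice_mul (P.Spp_cont i j) (h.1 j)).add
    (memLp_slice_mul (P.Spm_cont i) h.2)

theorem InL2.memLp_sourceMinus {P : Plant} {a : ℝ → Fin 3 → ℝ} {b : ℝ → ℝ} (h : InL2 P.L a b) :
    MemLp (sourceMinus P a) 2 (volume.restrict (Ioc 0 P.L)) :=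
  memLp_finsetSum _ fun j _ => memLp_slice_mul (P.Smp_cont j) (h.1 j)

theorem Icc_subset_timeDomain {T : EReal} {τ : ℝ} (hτ : τ ∈ timeDomain T) :
    Icc 0 τ ⊆ timeDomain T := fun _ ht =>
  ⟨ht.1, (EReal.coe_le_coe_iff.2 ht.2).trans_lt hτ.2⟩

theorem line_mem_rect {L τ κ b s t r : ℝ} (hs : (s, b + κ * s) ∈ Icc 0 τ ×ˢ Icc 0 L)
    (ht : (t, b + κ * t) ∈ Icc 0 τ ×ˢ Icc 0 L) (hr : r ∈ Icc s t) :
    (r, b + κ * r) ∈ Icc 0 τ ×ˢ Icc 0 L := by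
  rw [← trapezoid_zero] at *
  exact line_mem_trapezoid hs ht hr

theorem transportedOn_rect {κ L τ : ℝ} {Y F : ℝ → ℝ → ℝ} {S : Set ℝ} (hS : Icc 0 τ ⊆ S)
    (h : ∀ᵐ b : ℝ, ∀ s ∈ S, ∀ t ∈ S, s ≤ t → b + κ * s ∈ Icc 0 L → b + κ * t ∈ Icc 0 L →
      IntervalIntegrable (fun r => F r (b + κ * r)) volume s t ∧
        Y t (b + κ * t) = Y s (b + κ * s) + ∫ r in s..t, F r (b + κ * r)) :
    TransportedOn κ (Icc 0 τ ×ˢ Icc 0 L) Y F := by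
  filter_upwards [h] with b hb s t hst hs ht
  refine ⟨(hb s (hS hs.1) t (hS ht.1) hst hs.2 ht.2).1, fun r hr => ?_⟩
  have hr' := line_mem_rect hs ht hr
  exact (hb s (hS hs.1) r (hS hr'.1) hr.1 hs.2 hr'.2).2

namespace IsSolution

variable {P : Plant} {T : EReal} {U : ℝ → ℝ} {u : ℝ → ℝ → Fin 3 → ℝ} {v : ℝ → ℝ → ℝ} {τ : ℝ}
  {K : Fin 3 → ℝ × ℝ → ℝ} {M : ℝ × ℝ → ℝ}

theorem exists_normSq_le (h : IsSolution P T U u v) (hτ : τ ∈ timeDomain T) :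
    ∃ C, ∀ t ∈ Icc 0 τ, normSq P.L (u t) (v t) ≤ C := by
  have hsub := Icc_subset_timeDomain hτ
  refine isCompact_Icc.induction_on (p := fun S => ∃ C, ∀ t ∈ S, normSq P.L (u t) (v t) ≤ C)
    ⟨0, by simp⟩ (fun S S' hS ⟨C, hC⟩ => ⟨C, fun t ht => hC t (hS ht)⟩)
    (fun S S' ⟨C, hC⟩ ⟨C', hC'⟩ => ⟨max C C', ?_⟩) fun t₀ ht₀ => ?_
  · rintro t (ht | ht)
    exacts [(hC t ht).trans (le_max_left _ _), (hC' t ht).trans (le_max_right _ _)]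
  · have hnear := ((h.cont t₀ (hsub ht₀)).mono_left (nhdsWithin_mono t₀ hsub)).eventually
      (gt_mem_nhds zero_lt_one)
    refine ⟨_, inter_mem hnear self_mem_nhdsWithin, 2 * (1 + normSq P.L (u t₀) (v t₀)), ?_⟩
    rintro t ⟨ht, htm⟩
    refine (normSq_le_two_mul_add P.L_pos.le (h.inL2 t (hsub htm))
      (h.inL2 t₀ (hsub ht₀))).trans ?_
    gcongr
    exact le_of_lt ht

theorem memLp_u (h : IsSolution P T U u v) (hτ : τ ∈ timeDomain T) (i : Fin 3) :
    MemLp (fun p : ℝ × ℝ => u p.1 p.2 i) 2 (volume.restrict (Icc 0 τ ×ˢ Icc 0 P.L)) := by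
  obtain ⟨C, hC⟩ := h.exists_normSq_le hτ
  have hin := fun t ht => h.inL2 t (Icc_subset_timeDomain hτ ht)
  exact memLp_rect (y := fun t x => u t x i) P.L_pos.le (h.meas_u i)
    (fun t ht => (hin t ht).1 i)
    fun t ht => ((hin t ht).integral_fst_sq_le P.L_pos.le i).trans (hC t ht)

theorem memLp_v (h : IsSolution P T U u v) (hτ : τ ∈ timeDomain T) :
    MemLp (fun p : ℝ × ℝ => v p.1 p.2) 2 (volume.restrict (Icc 0 τ ×ˢ Icc 0 P.L)) := by
  obtain ⟨C, hC⟩ := h.exists_normSq_le hτ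
  have hin := fun t ht => h.inL2 t (Icc_subset_timeDomain hτ ht)
  exact memLp_rect P.L_pos.le h.meas_v (fun t ht => (hin t ht).2)
    fun t ht => ((hin t ht).integral_snd_sq_le P.L_pos.le).trans (hC t ht)

theorem isTransportSolution_u (h : IsSolution P T U u v) (hτ : τ ∈ timeDomain T) (i : Fin 3) :
    IsTransportSolution (P.lam i) P.L τ (fun t x => u t x i)
      fun t => sourcePlus P (u t) (v t) i where
  memLp := h.memLp_u hτ i
  memLp_source := (memLp_finsetSum _ fun j _ =>
    memLp_rect_mul (P.Spp_cont i j) (h.memLp_u hτ j)).add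
    (memLp_rect_mul (P.Spm_cont i) (h.memLp_v hτ))
  memLp_slice t ht := (h.inL2 t (Icc_subset_timeDomain hτ ht)).1 i
  memLp_left := memLp_two_of_intervalIntegrable_sq hτ.1
    ((h.meas_u i).comp measurable_prodMk_right) ((h.trace τ hτ).1 i).1
  memLp_right := memLp_two_of_intervalIntegrable_sq hτ.1
    ((h.meas_u i).comp measurable_prodMk_right) ((h.trace τ hτ).1 i).2
  transported := transportedOn_rect (Icc_subset_timeDomain hτ) (h.char_u i)

theorem isTransportSolution_v (h : IsSolution P T U u v) (hτ : τ ∈ timeDomain T) :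
    IsTransportSolution (-P.lamMinus) P.L τ v fun t => sourceMinus P (u t) where
  memLp := h.memLp_v hτ
  memLp_source := memLp_finsetSum _ fun j _ => memLp_rect_mul (P.Smp_cont j) (h.memLp_u hτ j)
  memLp_slice t ht := (h.inL2 t (Icc_subset_timeDomain hτ ht)).2
  memLp_left := memLp_two_of_intervalIntegrable_sq hτ.1
    (h.meas_v.comp measurable_prodMk_right) (h.trace τ hτ).2.1
  memLp_right := memLp_two_of_intervalIntegrable_sq hτ.1
    (h.meas_v.comp measurable_prodMk_right) (h.trace τ hτ).2.2
  transported := transportedOn_rect (Icc_subset_timeDomain hτ) (by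
    simpa only [neg_mul, ← sub_eq_add_neg, sourceMinus] using h.char_v)

theorem exists_abs_volterra_le (h : IsSolution P T U u v) (hτ : τ ∈ timeDomain T)
    (hK : ∀ i, ContinuousOn (K i) (triangle P.L)) (hM : ContinuousOn M (triangle P.L)) :
    ∃ C, ∀ t ∈ Icc 0 τ, ∀ x ∈ Icc 0 P.L, |volterra K M (u t) (v t) x| ≤ C := by
  obtain ⟨C, hC⟩ := h.exists_normSq_le hτ
  obtain ⟨k, hKk, hMk⟩ := exists_abs_kernel_le hK hM
  have hk : 0 ≤ k := (abs_nonneg _).trans (hMk (0, 0) ⟨le_rfl, le_rfl, P.L_pos.le⟩)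
  refine ⟨k * (4 * P.L + C), fun t ht x hx => (abs_volterra_le hKk hMk
    (h.inL2 t (Icc_subset_timeDomain hτ ht)) hx).trans ?_⟩
  gcongr
  exact hC t ht

theorem memLp_volterra (h : IsSolution P T U u v) (hτ : τ ∈ timeDomain T)
    (hK : ∀ i, ContinuousOn (K i) (triangle P.L)) (hM : ContinuousOn M (triangle P.L))
    {X : Type*} [MeasurableSpace X] {μ : Measure X} {S : Set X} [IsFiniteMeasure (μ.restrict S)]
    (hS : MeasurableSet S) {q : X → ℝ × ℝ} (hq : Measurable q)
    (hm : MapsTo q S (Icc 0 τ ×ˢ Icc 0 P.L)) :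
    MemLp (fun z => volterra K M (u (q z).1) (v (q z).1) (q z).2) 2 (μ.restrict S) := by
  obtain ⟨C, hC⟩ := h.exists_abs_volterra_le hτ hK hM
  obtain ⟨Φ, hΦ, hΦe⟩ := exists_measurable_volterra P.L_pos.le hK hM h.meas_u h.meas_v
  refine .of_bound ((hΦ.comp hq).aestronglyMeasurable.congr ?_) C
    (ae_restrict_of_forall_mem hS fun z hz => hC _ (hm hz).1 _ (hm hz).2)
  exact ae_restrict_of_forall_mem hS fun z hz => (hΦe _ _ (hm hz).2).symm

theorem inL2_backstep (h : IsSolution P T U u v) (hτ : τ ∈ timeDomain T)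
    (hK : ∀ i, ContinuousOn (K i) (triangle P.L)) (hM : ContinuousOn M (triangle P.L)) :
    InL2 P.L (u τ) (backstep K M (u τ) (v τ)) :=
  ⟨(h.inL2 τ hτ).1, (h.inL2 τ hτ).2.sub <| h.memLp_volterra hτ hK hM measurableSet_Ioc
    measurable_prodMk_left fun _ hx => ⟨right_mem_Icc.2 hτ.1, Ioc_subset_Icc_self hx⟩⟩

end IsSolution

theorem IsSolution.ae_intervalIntegrable_u_line {P : Plant} {T : EReal} {U : ℝ → ℝ}
    {u : ℝ → ℝ → Fin 3 → ℝ} {v : ℝ → ℝ → ℝ} {τ : ℝ} (h : IsSolution P T U u v)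
    (hτ : τ ∈ timeDomain T) (i : Fin 3) (κ : ℝ) :
    ∀ᵐ c : ℝ, ∀ s t, s ≤ t → (s, c + κ * s) ∈ Icc 0 τ ×ˢ Icc 0 P.L →
      (t, c + κ * t) ∈ Icc 0 τ ×ˢ Icc 0 P.L →
      IntervalIntegrable (fun r => u r (c + κ * r) i) volume s t := by
  filter_upwards [ae_integrableOn_line (F := fun r x => u r x i)
    (measurableSet_Icc.prod measurableSet_Icc) (h.isTransportSolution_u hτ i).integrableOn κ]
    with c hc s t hst hs ht
  exact (intervalIntegrable_iff_integrableOn_Ioc_of_le hst).2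
    (hc.mono_set fun r hr => line_mem_rect hs ht (Ioc_subset_Icc_self hr))

section KernelEquations

variable {P : Plant} {K : Fin 3 → ℝ × ℝ → ℝ} {M : ℝ × ℝ → ℝ} {a : ℝ → Fin 3 → ℝ} {b : ℝ → ℝ}
  {e x : ℝ}

theorem volterra_eq_sum (hK : ∀ i, ContinuousOn (K i) (triangle P.L))
    (hM : ContinuousOn M (triangle P.L)) (h : InL2 P.L a b) (he : e ∈ Icc 0 P.L) :
    volterra K M a b e =
      (∑ i, ∫ x in (0 : ℝ)..e, K i (e, x) * a x i) + ∫ x in (0 : ℝ)..e, M (e, x) * b x := by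
  have ha := fun i => intervalIntegrable_kernel_mul he (hK i) (h.1 i)
  rw [volterra, intervalIntegral.integral_add
    (by simpa only [Finset.sum_fn] using IntervalIntegrable.sum _ fun i _ => ha i)
    (intervalIntegrable_kernel_mul he hM h.2), intervalIntegral.integral_finsetSum fun i _ => ha i]

theorem IsBacksteppingKernel.rate_integrand_eq_zero (hKM : IsBacksteppingKernel P K M)
    (hx : (e, x) ∈ triangle P.L) :
    (∑ i, (fderivWithin ℝ (K i) (triangle P.L) (e, x) (-P.lamMinus, P.lam i) * a x i
        + K i (e, x) * sourcePlus P a b i x))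
      + (fderivWithin ℝ M (triangle P.L) (e, x) (-P.lamMinus, -P.lamMinus) * b x
        + M (e, x) * sourceMinus P a x) = 0 := by
  have hK := fun i => hKM.K_eq i _ hx
  have hM := hKM.M_eq _ hx
  simp only [fderivWithin_triangle_apply _ _ (-P.lamMinus), Fin.sum_univ_three, sourcePlus,
    sourceMinus] at hK hM ⊢
  linear_combination -(a x 0) * hK 0 - a x 1 * hK 1 - a x 2 * hK 2 - b x * hM

theorem IsBacksteppingKernel.sum_kernelRate (hKM : IsBacksteppingKernel P K M)
    (h : InL2 P.L a b) (hbdry : ∀ i, a 0 i = P.Q i * b 0) (he : e ∈ Icc 0 P.L) :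
    (∑ i, kernelRate P.L (P.lam i) P.lamMinus (K i) (fun x => a x i) (sourcePlus P a b i) e)
      + kernelRate P.L (-P.lamMinus) P.lamMinus M b (sourceMinus P a) e = sourceMinus P a e := by
  have hint : ∀ {k : ℝ × ℝ → ℝ} (q : ℝ × ℝ) {y f : ℝ → ℝ}, ContDiffOn ℝ 1 k (triangle P.L) →
      MemLp y 2 (volume.restrict (Ioc 0 P.L)) → MemLp f 2 (volume.restrict (Ioc 0 P.L)) →
      IntervalIntegrable (fun x => fderivWithin ℝ k (triangle P.L) (e, x) q * y x
        + k (e, x) * f x) volume 0 e := fun q _ _ hk hy hf =>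
    (intervalIntegrable_kernel_mul he (continuousOn_fderivWithin_triangle P.L_pos hk q) hy).add
      (intervalIntegrable_kernel_mul he hk.continuousOn hf)
  have hintK := fun i =>
    hint (-P.lamMinus, P.lam i) (hKM.K_smooth i) (h.1 i) (h.memLp_sourcePlus i)
  have hinterior := (intervalIntegral.integral_add
    (by simpa only [Finset.sum_fn] using IntervalIntegrable.sum Finset.univ fun i _ => hintK i)
    (hint (-P.lamMinus, -P.lamMinus) hKM.M_smooth h.2 h.memLp_sourceMinus)).symm.trans <|
    (intervalIntegral.integral_congr (g := fun _ => 0) fun x hx => by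
      rw [uIcc_of_le he.1] at hx
      exact hKM.rate_integrand_eq_zero ⟨hx.1, hx.2, he.2⟩).trans intervalIntegral.integral_zero
  rw [intervalIntegral.integral_finsetSum fun i _ => hintK i] at hinterior
  have hzero : (∑ i, P.lam i * (K i (e, 0) * a 0 i)) = P.lamMinus * (M (e, 0) * b 0) := by
    simp only [hbdry, ← mul_assoc P.lamMinus, hKM.M_bdry e he, Finset.sum_mul]
    exact Finset.sum_congr rfl fun i _ => by ring
  have hdiag : ∑ i, (P.lam i + P.lamMinus) * (K i (e, e) * a e i) = -sourceMinus P a e := by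
    rw [sourceMinus, ← Finset.sum_neg_distrib]
    exact Finset.sum_congr rfl fun i _ => by linear_combination a e i * hKM.K_diag i e he
  simp only [kernelRate, Finset.sum_add_distrib, Finset.sum_sub_distrib, hzero, hdiag,
    neg_add_cancel]
  linear_combination hinterior

end KernelEquations

theorem backstep_zero (K : Fin 3 → ℝ × ℝ → ℝ) (M : ℝ × ℝ → ℝ) (a : ℝ → Fin 3 → ℝ) (b : ℝ → ℝ) :
    backstep K M a b 0 = b 0 := by
  simp only [backstep, volterra, intervalIntegral.integral_same, sub_zero]

namespace IsSolution

variable {P : Plant} {T : EReal} {U : ℝ → ℝ} {u : ℝ → ℝ → Fin 3 → ℝ} {v : ℝ → ℝ → ℝ} {τ : ℝ}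
  {K : Fin 3 → ℝ × ℝ → ℝ} {M : ℝ × ℝ → ℝ}

theorem isPrimitive_volterra (h : IsSolution P T U u v) (hτ : τ ∈ timeDomain T)
    (hKM : IsBacksteppingKernel P K M) {e s t : ℝ} (hs : 0 ≤ s) (hst : s ≤ t) (ht : t ≤ τ)
    (he : ∀ r ∈ Icc s t, e - P.lamMinus * r ∈ Icc 0 P.L)
    (hu : ∀ i, IntervalIntegrable (fun r => u r (e - P.lamMinus * r) i) volume s t) :
    IsPrimitive (fun r => volterra K M (u r) (v r) (e - P.lamMinus * r))
      (fun r => sourceMinus P (u r) (e - P.lamMinus * r)) s t := by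
  have hdom := fun r (hr : r ∈ Icc s t) =>
    Icc_subset_timeDomain hτ ⟨hs.trans hr.1, hr.2.trans ht⟩
  have hK := fun i => (h.isTransportSolution_u hτ i).isPrimitive_integral_kernel P.L_pos
    (.inl ⟨P.lam_pos i, (add_pos (P.lam_pos i) P.lamMinus_pos).le⟩) hs hst ht he
    (hKM.K_smooth i) fun _ => hu i
  have hM := (h.isTransportSolution_v hτ).isPrimitive_integral_kernel P.L_pos
    (.inr ⟨neg_neg_of_pos P.lamMinus_pos, (neg_add_cancel _).le⟩) hs hst ht he hKM.M_smooth
    fun hne => absurd (neg_add_cancel _) hne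
  exact ((IsPrimitive.sum _ fun i _ => hK i).add hM).congr hst
    (fun r hr => (volterra_eq_sum (fun i => (hKM.K_smooth i).continuousOn)
      hKM.M_smooth.continuousOn (h.inL2 r (hdom r hr)) (he r hr)).symm)
    fun r hr => hKM.sum_kernelRate (h.inL2 r (hdom r hr)) (h.bdry_zero r (hdom r hr)) (he r hr)

theorem transportedOn_backstep (h : IsSolution P T U u v) (hτ : τ ∈ timeDomain T)
    (hKM : IsBacksteppingKernel P K M) :
    TransportedOn (-P.lamMinus) (Icc 0 τ ×ˢ Icc 0 P.L)
      (fun t => backstep K M (u t) (v t)) fun _ _ => 0 := by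
  filter_upwards [(h.isTransportSolution_v hτ).transported,
    ae_all_iff.2 fun i => h.ae_intervalIntegrable_u_line hτ i (-P.lamMinus)]
    with c hv hu s t hst hs ht
  have hv := hv s t hst hs ht
  have hu := fun i => hu i s t hst hs ht
  have hline := fun r (hr : r ∈ Icc s t) => (line_mem_rect hs ht hr).2
  simp only [neg_mul, ← sub_eq_add_neg] at hv hu hline ⊢
  exact (hv.sub (h.isPrimitive_volterra hτ hKM hs.1.1 hst ht.1.2 hline hu)).congr hst
    (fun _ _ => rfl) fun _ _ => sub_self _

theorem isTransportSolution_backstep (h : IsSolution P T U u v) (hτ : τ ∈ timeDomain T)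
    (hKM : IsBacksteppingKernel P K M) :
    IsTransportSolution (-P.lamMinus) P.L τ (fun t => backstep K M (u t) (v t))
      fun _ _ => 0 := by
  have := isFiniteMeasure_restrict_rect τ P.L
  have hK := fun i => (hKM.K_smooth i).continuousOn
  have hM := hKM.M_smooth.continuousOn
  have hv := h.isTransportSolution_v hτ
  refine ⟨hv.memLp.sub ?_, MemLp.zero, fun r hr => ?_, ?_, hv.memLp_right.sub ?_,
    h.transportedOn_backstep hτ hKM⟩
  · exact h.memLp_volterra hτ hK hM (measurableSet_Icc.prod measurableSet_Icc) measurable_id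
      (mapsTo_id _)
  · exact (h.inL2_backstep (Icc_subset_timeDomain hτ hr) hK hM).2
  · simpa only [backstep_zero] using hv.memLp_left
  · exact h.memLp_volterra hτ hK hM measurableSet_Ioc measurable_prodMk_right fun r hr =>
      ⟨Ioc_subset_Icc_self hr, right_mem_Icc.2 P.L_pos.le⟩

end IsSolution

section Lyapunov

/-- The weight of the `i`-th rightgoing component in the Lyapunov functional. -/
def weightPlus (P : Plant) (D : Design) (i : Fin 3) (x : ℝ) : ℝ :=
  D.A i / P.lam i * Real.exp (-(D.μ * x / P.lam i))

/-- The weight of the leftgoing component in the Lyapunov functional. -/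
def weightMinus (P : Plant) (D : Design) (x : ℝ) : ℝ :=
  D.B / P.lamMinus * Real.exp (D.μ * x / P.lamMinus)

theorem hasDerivAt_weightPlus (P : Plant) (D : Design) (i : Fin 3) (x : ℝ) :
    HasDerivAt (weightPlus P D i) (-(D.μ / P.lam i) * weightPlus P D i x) x := by
  have : HasDerivAt (fun x => -(D.μ * x / P.lam i)) (-(D.μ / P.lam i)) x := by
    simpa using (((hasDerivAt_id x).const_mul D.μ).div_const (P.lam i)).fun_neg
  exact ((this.exp).const_mul (D.A i / P.lam i)).congr_deriv (by simp only [weightPlus]; ring)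

theorem hasDerivAt_weightMinus (P : Plant) (D : Design) (x : ℝ) :
    HasDerivAt (weightMinus P D) (D.μ / P.lamMinus * weightMinus P D x) x := by
  have : HasDerivAt (fun x => D.μ * x / P.lamMinus) (D.μ / P.lamMinus) x := by
    simpa using ((hasDerivAt_id x).const_mul D.μ).div_const P.lamMinus
  exact ((this.exp).const_mul (D.B / P.lamMinus)).congr_deriv
    (by simp only [weightMinus]; ring)

theorem continuous_weightPlus (P : Plant) (D : Design) (i : Fin 3) :
    Continuous (weightPlus P D i) :=
  continuous_iff_continuousAt.2 fun x => (hasDerivAt_weightPlus P D i x).continuousAt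

theorem continuous_weightMinus (P : Plant) (D : Design) : Continuous (weightMinus P D) :=
  continuous_iff_continuousAt.2 fun x => (hasDerivAt_weightMinus P D x).continuousAt

theorem lam_mul_weightPlus (P : Plant) (D : Design) (i : Fin 3) (x : ℝ) :
    P.lam i * weightPlus P D i x = D.A i * Real.exp (-(D.μ * x / P.lam i)) := by
  rw [weightPlus, ← mul_assoc, mul_div_cancel₀ _ (P.lam_pos i).ne']

theorem lamMinus_mul_weightMinus (P : Plant) (D : Design) (x : ℝ) :
    P.lamMinus * weightMinus P D x = D.B * Real.exp (D.μ * x / P.lamMinus) := by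
  rw [weightMinus, ← mul_assoc, mul_div_cancel₀ _ P.lamMinus_pos.ne']

theorem intervalIntegrable_continuous_mul {L : ℝ} (hL : 0 ≤ L) {φ g : ℝ → ℝ} (hφ : Continuous φ)
    (hg : IntegrableOn g (Ioc 0 L)) : IntervalIntegrable (fun x => φ x * g x) volume 0 L :=
  ((intervalIntegrable_iff_integrableOn_Ioc_of_le hL).2 hg).continuousOn_mul hφ.continuousOn

variable {P : Plant} {a : ℝ → Fin 3 → ℝ} {b β : ℝ → ℝ}

theorem lyapunov_eq_sum (D : Design) (h : InL2 P.L a β) : lyapunov P D a β =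
    (∑ i, ∫ x in (0 : ℝ)..P.L, weightPlus P D i x * a x i ^ 2)
      + ∫ x in (0 : ℝ)..P.L, weightMinus P D x * β x ^ 2 := by
  have ha := fun i => intervalIntegrable_continuous_mul P.L_pos.le (continuous_weightPlus P D i)
    (h.1 i).integrable_sq
  rw [← intervalIntegral.integral_finsetSum fun i _ => ha i, ← intervalIntegral.integral_add
    (by simpa only [Finset.sum_fn] using IntervalIntegrable.sum _ fun i _ => ha i)
    (intervalIntegrable_continuous_mul P.L_pos.le (continuous_weightMinus P D)
      h.2.integrable_sq)]
  rfl

theorem InL2.intervalIntegrable_weight_source (D : Design) (h : InL2 P.L a b) (i : Fin 3) :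
    IntervalIntegrable (fun x => 2 * weightPlus P D i x * (a x i * sourcePlus P a b i x))
      volume 0 P.L :=
  intervalIntegrable_continuous_mul P.L_pos.le ((continuous_weightPlus P D i).const_mul 2)
    ((h.1 i).integrable_mul (h.memLp_sourcePlus i))

/-- The time derivative of the Lyapunov functional `V` when the state is `(a, b)` and its
transform is `(a, β)`. -/
def lyapunovRate (P : Plant) (D : Design) (a : ℝ → Fin 3 → ℝ) (b β : ℝ → ℝ) : ℝ :=
  (∑ i, (D.A i * a 0 i ^ 2 - D.A i * Real.exp (-(D.μ * P.L / P.lam i)) * a P.L i ^ 2))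
    + (D.B * Real.exp (D.μ * P.L / P.lamMinus) * β P.L ^ 2 - D.B * β 0 ^ 2)
    - D.μ * lyapunov P D a β
    + ∑ i, ∫ x in (0 : ℝ)..P.L, 2 * weightPlus P D i x * (a x i * sourcePlus P a b i x)

theorem energyRate_plus (D : Design) (h : InL2 P.L a b) (i : Fin 3) :
    P.lam i * (weightPlus P D i 0 * a 0 i ^ 2) - P.lam i * (weightPlus P D i P.L * a P.L i ^ 2)
      + ∫ x in (0 : ℝ)..P.L, (P.lam i * (-(D.μ / P.lam i) * weightPlus P D i x) * a x i ^ 2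
        + 2 * weightPlus P D i x * (a x i * sourcePlus P a b i x))
    = D.A i * a 0 i ^ 2 - D.A i * Real.exp (-(D.μ * P.L / P.lam i)) * a P.L i ^ 2
      - D.μ * (∫ x in (0 : ℝ)..P.L, weightPlus P D i x * a x i ^ 2)
      + ∫ x in (0 : ℝ)..P.L, 2 * weightPlus P D i x * (a x i * sourcePlus P a b i x) := by
  have hweight : ∀ x, P.lam i * (-(D.μ / P.lam i) * weightPlus P D i x) * a x i ^ 2
      = -D.μ * (weightPlus P D i x * a x i ^ 2) := fun x => by
    have := (P.lam_pos i).ne'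
    field_simp
  simp only [hweight]
  rw [intervalIntegral.integral_add ((intervalIntegrable_continuous_mul P.L_pos.le
    (continuous_weightPlus P D i) (h.1 i).integrable_sq).const_mul _)
    (h.intervalIntegrable_weight_source D i), intervalIntegral.integral_const_mul,
    ← mul_assoc, ← mul_assoc, lam_mul_weightPlus, lam_mul_weightPlus, mul_zero, zero_div,
    neg_zero, Real.exp_zero, mul_one]
  ring

theorem energyRate_minus (P : Plant) (D : Design) (β : ℝ → ℝ) :
    -P.lamMinus * (weightMinus P D 0 * β 0 ^ 2)
      - -P.lamMinus * (weightMinus P D P.L * β P.L ^ 2)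
      + ∫ x in (0 : ℝ)..P.L, (-P.lamMinus * (D.μ / P.lamMinus * weightMinus P D x) * β x ^ 2
        + 2 * weightMinus P D x * (β x * 0))
    = D.B * Real.exp (D.μ * P.L / P.lamMinus) * β P.L ^ 2 - D.B * β 0 ^ 2
      - D.μ * ∫ x in (0 : ℝ)..P.L, weightMinus P D x * β x ^ 2 := by
  have hweight : ∀ x, -P.lamMinus * (D.μ / P.lamMinus * weightMinus P D x) * β x ^ 2
      + 2 * weightMinus P D x * (β x * 0) = -D.μ * (weightMinus P D x * β x ^ 2) := fun x => by
    have := P.lamMinus_pos.ne'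
    field_simp
    ring
  have hzero := lamMinus_mul_weightMinus P D 0
  rw [mul_zero, zero_div, Real.exp_zero, mul_one] at hzero
  simp only [hweight, intervalIntegral.integral_const_mul]
  linear_combination β P.L ^ 2 * lamMinus_mul_weightMinus P D P.L - β 0 ^ 2 * hzero

theorem IsSolution.isPrimitive_lyapunov {T : EReal} {U : ℝ → ℝ} {u : ℝ → ℝ → Fin 3 → ℝ}
    {v : ℝ → ℝ → ℝ} {τ : ℝ} {K : Fin 3 → ℝ × ℝ → ℝ} {M : ℝ × ℝ → ℝ} (D : Design)
    (h : IsSolution P T U u v) (hτ : τ ∈ timeDomain T) (hKM : IsBacksteppingKernel P K M) :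
    IsPrimitive (fun t => lyapunov P D (u t) (backstep K M (u t) (v t)))
      (fun t => lyapunovRate P D (u t) (v t) (backstep K M (u t) (v t))) 0 τ := by
  have hdom := fun r hr => Icc_subset_timeDomain hτ (a := r) hr
  have hϑ := fun r hr => h.inL2_backstep (hdom r hr) (fun i => (hKM.K_smooth i).continuousOn)
    hKM.M_smooth.continuousOn
  have hu := fun i => (h.isTransportSolution_u hτ i).isPrimitive_energy (P.lam_pos i).ne' hτ.1
    P.L_pos.le (hasDerivAt_weightPlus P D i) ((continuous_weightPlus P D i).const_mul _)
  have hβ := (h.isTransportSolution_backstep hτ hKM).isPrimitive_energy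
    (neg_ne_zero.2 P.lamMinus_pos.ne') hτ.1 P.L_pos.le (hasDerivAt_weightMinus P D)
    ((continuous_weightMinus P D).const_mul _)
  refine ((IsPrimitive.sum Finset.univ fun i _ => hu i).add hβ).congr hτ.1
    (fun r hr => (lyapunov_eq_sum D (hϑ r hr)).symm) fun r hr => ?_
  simp only [energyRate_plus D (h.inL2 r (hdom r hr)), energyRate_minus, lyapunovRate,
    lyapunov_eq_sum D (hϑ r hr), Finset.sum_add_distrib, Finset.sum_sub_distrib,
    ← Finset.mul_sum]
  ring

end Lyapunov

section SourceBound

variable {P : Plant} {D : Design}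

theorem bddAbove_norm_Spp (P : Plant) :
    BddAbove ((fun x => ‖Matrix.toEuclideanCLM (𝕜 := ℝ) (P.Spp x)‖) '' Icc 0 P.L) := by
  have hSpp : ContinuousOn P.Spp (Icc 0 P.L) :=
    continuousOn_pi.2 fun i => continuousOn_pi.2 fun j => P.Spp_cont i j
  have hCLM : Continuous fun S : Matrix (Fin 3) (Fin 3) ℝ => Matrix.toEuclideanCLM (𝕜 := ℝ) S :=
    LinearMap.continuous_of_finiteDimensional
      (Matrix.toEuclideanCLM (n := Fin 3) (𝕜 := ℝ)).toAlgEquiv.toLinearMap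
  exact isCompact_Icc.bddAbove_image (hCLM.comp_continuousOn hSpp).norm

theorem bddAbove_norm_Spm (P : Plant) :
    BddAbove ((fun x => ‖WithLp.toLp 2 (P.Spm x)‖) '' Icc 0 P.L) :=
  isCompact_Icc.bddAbove_image
    ((PiLp.continuous_toLp 2 _).comp_continuousOn (continuousOn_pi.2 P.Spm_cont)).norm

theorem supSpp_nonneg (P : Plant) : 0 ≤ supSpp P :=
  Real.sSup_nonneg (by rintro _ ⟨x, -, rfl⟩; exact norm_nonneg _)

theorem supSpm_nonneg (P : Plant) : 0 ≤ supSpm P :=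
  Real.sSup_nonneg (by rintro _ ⟨x, -, rfl⟩; exact norm_nonneg _)

theorem iInf_lam_pos (P : Plant) : 0 < ⨅ i, P.lam i := by
  obtain ⟨i, hi⟩ := exists_eq_ciInf_of_finite (f := P.lam)
  exact hi ▸ P.lam_pos i

theorem gammaConst_nonneg (hA : ∀ i, 0 ≤ D.A i) {p₁ p₃ : ℝ} (hp₁ : 0 ≤ p₁) (hp₃ : 0 ≤ p₃) :
    0 ≤ gammaConst P D p₁ p₃ := by
  have hA := Real.iSup_nonneg hA
  have hlam := (iInf_lam_pos P).le
  have hSpp := supSpp_nonneg P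
  have hSpm := supSpm_nonneg P
  unfold gammaConst
  positivity

theorem weightPlus_nonneg (hA : ∀ i, 0 ≤ D.A i) (i : Fin 3) (x : ℝ) : 0 ≤ weightPlus P D i x :=
  mul_nonneg (div_nonneg (hA i) (P.lam_pos i).le) (Real.exp_pos _).le

theorem weightPlus_le (hA : ∀ i, 0 ≤ D.A i) (hμ : 0 ≤ D.μ) (i : Fin 3) {x : ℝ} (hx : 0 ≤ x) :
    weightPlus P D i x ≤ (⨆ i, D.A i) / ⨅ i, P.lam i := by
  have hexp : Real.exp (-(D.μ * x / P.lam i)) ≤ 1 :=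
    Real.exp_le_one_iff.2 (neg_nonpos.2 (div_nonneg (mul_nonneg hμ hx) (P.lam_pos i).le))
  exact (mul_le_of_le_one_right (div_nonneg (hA i) (P.lam_pos i).le) hexp).trans <|
    div_le_div₀ (Real.iSup_nonneg hA) (le_ciSup (Finite.bddAbove_range D.A) i) (iInf_lam_pos P)
      (ciInf_le (Finite.bddBelow_range P.lam) i)

theorem norm_toLp_mul_le {ι : Type*} [Fintype ι] {c : ℝ} (hc : 0 ≤ c) {φ : ι → ℝ}
    (hφ : ∀ i, |φ i| ≤ c) (a : ι → ℝ) :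
    ‖WithLp.toLp 2 fun i => φ i * a i‖ ≤ c * ‖WithLp.toLp 2 a‖ := by
  refine (abs_le_of_sq_le_sq' ?_ (by positivity)).2
  rw [mul_pow, EuclideanSpace.real_norm_sq_eq, EuclideanSpace.real_norm_sq_eq, Finset.mul_sum]
  refine Finset.sum_le_sum fun i _ => ?_
  rw [mul_pow]
  exact mul_le_mul_of_nonneg_right (sq_le_sq' (abs_le.1 (hφ i)).1 (abs_le.1 (hφ i)).2)
    (sq_nonneg _)

theorem sum_weight_source_le {ι : Type*} [Fintype ι] [DecidableEq ι] {c : ℝ} (hc : 0 ≤ c)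
    {φ : ι → ℝ} (hφ : ∀ i, |φ i| ≤ c) (a s : ι → ℝ) (S : Matrix ι ι ℝ) (b : ℝ) :
    ∑ i, φ i * (a i * ((∑ j, S i j * a j) + s i * b)) ≤
      c * (‖Matrix.toEuclideanCLM (𝕜 := ℝ) S‖ * ∑ i, a i ^ 2
        + ‖WithLp.toLp 2 s‖ * ((∑ i, a i ^ 2) + b ^ 2)) := by
  let a' : EuclideanSpace ℝ ι := WithLp.toLp 2 a
  let s' : EuclideanSpace ℝ ι := WithLp.toLp 2 s
  let φa : EuclideanSpace ℝ ι := WithLp.toLp 2 fun i => φ i * a i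
  have hsq : ∑ i, a i ^ 2 = ‖a'‖ ^ 2 := (EuclideanSpace.real_norm_sq_eq a').symm
  have hyoung : ‖a'‖ * |b| ≤ ‖a'‖ ^ 2 + b ^ 2 := by
    nlinarith [sq_nonneg (‖a'‖ - |b|), sq_abs b, sq_nonneg ‖a'‖, sq_nonneg b]
  calc ∑ i, φ i * (a i * ((∑ j, S i j * a j) + s i * b))
      = inner ℝ φa (Matrix.toEuclideanCLM (𝕜 := ℝ) S a' + b • s') := by
        simp only [PiLp.inner_apply, PiLp.add_apply, PiLp.smul_apply, smul_eq_mul,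
          RCLike.inner_apply, conj_trivial, Matrix.ofLp_toEuclideanCLM, Matrix.mulVec, dotProduct,
          a', s', φa]
        exact Finset.sum_congr rfl fun i _ => by ring
    _ ≤ ‖φa‖ * (‖Matrix.toEuclideanCLM (𝕜 := ℝ) S a'‖ + ‖b • s'‖) :=
        (real_inner_le_norm _ _).trans (by gcongr; exact norm_add_le _ _)
    _ ≤ (c * ‖a'‖) * (‖Matrix.toEuclideanCLM (𝕜 := ℝ) S‖ * ‖a'‖ + |b| * ‖s'‖) := by
        rw [norm_smul, Real.norm_eq_abs]
        gcongr
        exacts [norm_toLp_mul_le hc hφ a, ContinuousLinearMap.le_opNorm _ _]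
    _ = c * (‖Matrix.toEuclideanCLM (𝕜 := ℝ) S‖ * ‖a'‖ ^ 2 + ‖s'‖ * (‖a'‖ * |b|)) := by ring
    _ ≤ _ := by rw [hsq]; gcongr

variable {a : ℝ → Fin 3 → ℝ} {b β : ℝ → ℝ}

theorem sum_integral_weight_source_le (hA : ∀ i, 0 ≤ D.A i) (hμ : 0 ≤ D.μ) (hab : InL2 P.L a b)
    (haβ : InL2 P.L a β) :
    ∑ i, ∫ x in (0 : ℝ)..P.L, 2 * weightPlus P D i x * (a x i * sourcePlus P a b i x) ≤
      2 * ((⨆ i, D.A i) / ⨅ i, P.lam i) *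
        (supSpp P * normSq P.L a β + supSpm P * normSq P.L a b) := by
  have hc : 0 ≤ 2 * ((⨆ i, D.A i) / ⨅ i, P.lam i) :=
    mul_nonneg zero_le_two (div_nonneg (Real.iSup_nonneg hA) (iInf_lam_pos P).le)
  have hweight : ∀ i, ∀ x ∈ Icc 0 P.L,
      |2 * weightPlus P D i x| ≤ 2 * ((⨆ i, D.A i) / ⨅ i, P.lam i) := fun i x hx => by
    rw [abs_of_nonneg (mul_nonneg zero_le_two (weightPlus_nonneg hA i x))]
    exact mul_le_mul_of_nonneg_left (weightPlus_le hA hμ i hx.1) zero_le_two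
  have hsq : ∀ {b}, InL2 P.L a b →
      IntervalIntegrable (fun x => (∑ i, a x i ^ 2) + b x ^ 2) volume 0 P.L := fun h =>
    (intervalIntegrable_iff_integrableOn_Ioc_of_le P.L_pos.le).2 h.integrableOn_sq
  have hsource := hab.intervalIntegrable_weight_source D
  have hSpp := supSpp_nonneg P
  rw [← intervalIntegral.integral_finsetSum fun i _ => hsource i, normSq, normSq,
    ← intervalIntegral.integral_const_mul, ← intervalIntegral.integral_const_mul,
    ← intervalIntegral.integral_add ((hsq haβ).const_mul _) ((hsq hab).const_mul _),
    ← intervalIntegral.integral_const_mul]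
  refine intervalIntegral.integral_mono_on P.L_pos.le
    (by simpa only [Finset.sum_fn] using IntervalIntegrable.sum _ fun i _ => hsource i)
    ((((hsq haβ).const_mul _).add ((hsq hab).const_mul _)).const_mul _) fun x hx => ?_
  refine (sum_weight_source_le hc (fun i => hweight i x hx) (a x) (P.Spm x) (P.Spp x)
    (b x)).trans ?_
  gcongr
  · exact le_csSup (bddAbove_norm_Spp P) (mem_image_of_mem _ hx)
  · exact le_add_of_nonneg_right (sq_nonneg _)
  · exact le_csSup (bddAbove_norm_Spm P) (mem_image_of_mem _ hx)

theorem sum_integral_weight_source_le_gammaConst_mul (hA : ∀ i, 0 ≤ D.A i) (hμ : 0 ≤ D.μ)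
    {p₁ p₃ p₄ : ℝ} (hp₁ : 0 < p₁) (hp₃ : 0 < p₃) (hp₃₄ : LyapunovBounds P D p₃ p₄)
    (hab : InL2 P.L a b) (haβ : InL2 P.L a β) (hle : p₁ * normSq P.L a b ≤ normSq P.L a β) :
    ∑ i, ∫ x in (0 : ℝ)..P.L, 2 * weightPlus P D i x * (a x i * sourcePlus P a b i x) ≤
      gammaConst P D p₁ p₃ * lyapunov P D a β := by
  have hc : 0 ≤ (⨆ i, D.A i) / ⨅ i, P.lam i :=
    div_nonneg (Real.iSup_nonneg hA) (iInf_lam_pos P).le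
  have hnorm : normSq P.L a b ≤ (1 + 1 / p₁) * normSq P.L a β := by
    have hdiv : normSq P.L a b ≤ 1 / p₁ * normSq P.L a β := by
      rwa [one_div, ← div_eq_inv_mul, le_div_iff₀' hp₁]
    linarith [normSq_nonneg P.L_pos.le a β]
  have hSpm := supSpm_nonneg P
  calc _ ≤ 2 * ((⨆ i, D.A i) / ⨅ i, P.lam i) *
        (supSpp P * normSq P.L a β + supSpm P * normSq P.L a b) :=
        sum_integral_weight_source_le hA hμ hab haβ
    _ ≤ 2 * ((⨆ i, D.A i) / ⨅ i, P.lam i) *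
        (supSpp P * normSq P.L a β + supSpm P * ((1 + 1 / p₁) * normSq P.L a β)) := by gcongr
    _ = gammaConst P D p₁ p₃ * (p₃ * normSq P.L a β) := by
        have := (iInf_lam_pos P).ne'
        rw [gammaConst]
        field_simp
    _ ≤ gammaConst P D p₁ p₃ * lyapunov P D a β :=
        mul_le_mul_of_nonneg_left (hp₃₄ a β haβ).1 (gammaConst_nonneg hA hp₁.le hp₃.le)

end SourceBound

theorem exists_lt_lt_succ {X : Type*} [LinearOrder X] {s : ℕ → X} {x : X} (h₀ : s 0 ≤ x)
    (hlt : ∃ k, x < s k) (hne : ∀ k, x ≠ s k) : ∃ k, s k < x ∧ x < s (k + 1) := by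
  by_contra! hstep
  obtain ⟨k, hk⟩ := hlt
  exact hk.not_ge (Nat.rec h₀ (fun n hn => hstep n (hn.lt_of_ne' (hne n))) k)

theorem mRate_le_of_not_triggered {P : Plant} {D : Design} (hζ : 0 < D.ζ)
    (hς : ∀ i, 0 ≤ D.ς i) (hς₄ : 0 ≤ D.ς₄) {d V m : ℝ} (h : ¬ Triggered P D d V m)
    (αL : Fin 3 → ℝ) (β0 : ℝ) : mRate P D m d V αL β0 ≤ -(D.η + 1 / D.ζ) * m := by
  rw [Triggered, ge_iff_le, not_le] at h
  have hd : D.B * Real.exp (D.μ * P.L / P.lamMinus) * d ^ 2 ≤ D.σ * D.μ * V - 1 / D.ζ * m := by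
    refine le_of_mul_le_mul_left ?_ hζ
    have hcancel : D.ζ * (1 / D.ζ * m) = m := by field_simp
    linarith
  have hα : 0 ≤ ∑ i, D.ς i * αL i ^ 2 :=
    Finset.sum_nonneg fun i _ => mul_nonneg (hς i) (sq_nonneg _)
  have hβ : 0 ≤ D.ς₄ * β0 ^ 2 := mul_nonneg hς₄ (sq_nonneg _)
  rw [mRate]
  linarith

namespace IsClosedLoop

variable {P : Plant} {D : Design} {K : Fin 3 → ℝ × ℝ → ℝ} {M : ℝ × ℝ → ℝ}
  {G : Fin 3 → ℝ × ℝ → ℝ} {N : ℝ × ℝ → ℝ} {u : ℝ → ℝ → Fin 3 → ℝ} {v : ℝ → ℝ → ℝ}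
  {Ud m : ℝ → ℝ} {tk : ℕ → EReal} {τ : ℝ}

theorem isPrimitive_m (h : IsClosedLoop P D K M G N u v Ud m tk)
    (hτ : τ ∈ timeDomain (⨆ k, tk k)) :
    IsPrimitive m (fun s => mRate P D (m s) (Ud s - feedback P K M G N (u s) (v s))
      (lyapunov P D (u s) (backstep K M (u s) (v s))) (u s P.L)
      (backstep K M (u s) (v s) 0)) 0 τ :=
  ⟨(h.m_eq τ hτ).1, fun r hr => (h.m_eq r (Icc_subset_timeDomain hτ hr)).2⟩

theorem backstep_L (h : IsClosedLoop P D K M G N u v Ud m tk) (hGN : IsInverseKernel P K M G N)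
    (hτ : τ ∈ timeDomain (⨆ k, tk k)) :
    backstep K M (u τ) (v τ) P.L = Ud τ - feedback P K M G N (u τ) (v τ) := by
  have hinv := hGN.left_inv _ _ (h.solution.inL2 τ hτ) P.L (right_mem_Icc.2 P.L_pos.le)
  rw [invBackstep] at hinv
  rw [feedback]
  linarith [h.solution.bdry_L τ hτ]

theorem not_triggered (h : IsClosedLoop P D K M G N u v Ud m tk)
    (hτ : τ ∈ timeDomain (⨆ k, tk k)) (hne : ∀ k, (τ : EReal) ≠ tk k) :
    ¬ Triggered P D (Ud τ - feedback P K M G N (u τ) (v τ))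
      (lyapunov P D (u τ) (backstep K M (u τ) (v τ))) (m τ) := by
  have hzero : tk 0 ≤ (τ : EReal) := h.time_zero.trans_le (EReal.coe_nonneg.2 hτ.1)
  obtain ⟨k, hk, hk'⟩ := exists_lt_lt_succ hzero (lt_iSup_iff.1 hτ.2) hne
  rw [h.hold k τ hk.le hk']
  intro htrig
  refine hk'.not_ge ?_
  rw [h.next k]
  exact sInf_le ⟨τ, ⟨hk, htrig⟩, rfl⟩

theorem ae_not_triggered (h : IsClosedLoop P D K M G N u v Ud m tk) :
    ∀ᵐ r : ℝ, r ∈ timeDomain (⨆ k, tk k) →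
      ¬ Triggered P D (Ud r - feedback P K M G N (u r) (v r))
        (lyapunov P D (u r) (backstep K M (u r) (v r))) (m r) := by
  have hcount : (range fun k => (tk k).toReal).Countable := countable_range _
  filter_upwards [hcount.ae_notMem volume] with r hr hrT
  exact h.not_triggered hrT fun k hk => hr ⟨k, by simp [← hk]⟩

theorem m_neg (h : IsClosedLoop P D K M G N u v Ud m tk) (hζ : 0 < D.ζ)
    (hς : ∀ i, 0 ≤ D.ς i) (hς₄ : 0 ≤ D.ς₄) (hτ : τ ∈ timeDomain (⨆ k, tk k)) : m τ < 0 := by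
  have hgrowth := (h.isPrimitive_m hτ).gronwall_le hτ.1 (κ := D.η + 1 / D.ζ) (by
    filter_upwards [h.ae_not_triggered] with r hr hrτ
    exact mRate_le_of_not_triggered hζ hς hς₄
      (hr (Icc_subset_timeDomain hτ (Ioc_subset_Icc_self hrτ))) _ _)
  exact hgrowth.trans_lt (mul_neg_of_pos_of_neg (Real.exp_pos _) h.m_zero)

variable {p₁ p₂ p₃ p₄ κ : ℝ}

theorem lyapunovRate_sub_mRate_le (h : IsClosedLoop P D K M G N u v Ud m tk)
    (hKM : IsBacksteppingKernel P K M) (hGN : IsInverseKernel P K M G N)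
    (hA : ∀ i, 0 ≤ D.A i) (hμ : 0 ≤ D.μ)
    (hsel : ∀ i, D.ς i - D.A i * Real.exp (-(D.μ * P.L / P.lam i)) ≤ 0)
    (hsel₄ : D.ς₄ + (∑ i, D.A i * P.Q i ^ 2) - D.B ≤ 0) (hp₁ : 0 < p₁) (hp₃ : 0 < p₃)
    (hp₁₂ : TransformBounds P K M p₁ p₂) (hp₃₄ : LyapunovBounds P D p₃ p₄)
    (hκ : κ ≤ decayRate P D p₁ p₃) (hκη : κ ≤ D.η) (hτ : τ ∈ timeDomain (⨆ k, tk k))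
    (hm : m τ ≤ 0) :
    lyapunovRate P D (u τ) (v τ) (backstep K M (u τ) (v τ))
        - mRate P D (m τ) (Ud τ - feedback P K M G N (u τ) (v τ))
          (lyapunov P D (u τ) (backstep K M (u τ) (v τ))) (u τ P.L)
          (backstep K M (u τ) (v τ) 0) ≤
      -κ * (lyapunov P D (u τ) (backstep K M (u τ) (v τ)) - m τ) := by
  have hw := h.solution.inL2 τ hτ
  have hϑ := h.solution.inL2_backstep hτ (fun i => (hKM.K_smooth i).continuousOn)
    hKM.M_smooth.continuousOn
  have hsource := sum_integral_weight_source_le_gammaConst_mul hA hμ hp₁ hp₃ hp₃₄ hw hϑ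
    (hp₁₂ _ _ hw).1
  have hV : 0 ≤ lyapunov P D (u τ) (backstep K M (u τ) (v τ)) :=
    (mul_nonneg hp₃.le (normSq_nonneg P.L_pos.le _ _)).trans (hp₃₄ _ _ hϑ).1
  have hoverflow : ∑ i, (D.ς i - D.A i * Real.exp (-(D.μ * P.L / P.lam i))) * u τ P.L i ^ 2 ≤ 0 :=
    Finset.sum_nonpos fun i _ => mul_nonpos_of_nonpos_of_nonneg (hsel i) (sq_nonneg _)
  have hinflow : ∑ i, D.A i * u τ 0 i ^ 2 = (∑ i, D.A i * P.Q i ^ 2) * v τ 0 ^ 2 := by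
    rw [Finset.sum_mul]
    exact Finset.sum_congr rfl fun i _ => by rw [h.solution.bdry_zero τ hτ i]; ring
  have hreflect := mul_nonpos_of_nonpos_of_nonneg hsel₄ (sq_nonneg (v τ 0))
  have hrate := mul_le_mul_of_nonneg_right hκ hV
  have hrate_m := mul_le_mul_of_nonpos_right hκη hm
  simp only [sub_mul, Finset.sum_sub_distrib] at hoverflow
  rw [decayRate] at hrate
  rw [lyapunovRate, mRate, h.backstep_L hGN hτ, backstep_zero, Finset.sum_sub_distrib, hinflow]
  linarith

theorem lyapunov_sub_m_le (h : IsClosedLoop P D K M G N u v Ud m tk)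
    (hKM : IsBacksteppingKernel P K M) (hGN : IsInverseKernel P K M G N)
    (hA : ∀ i, 0 ≤ D.A i) (hμ : 0 ≤ D.μ) (hζ : 0 < D.ζ) (hς : ∀ i, 0 ≤ D.ς i) (hς₄ : 0 ≤ D.ς₄)
    (hsel : ∀ i, D.ς i - D.A i * Real.exp (-(D.μ * P.L / P.lam i)) ≤ 0)
    (hsel₄ : D.ς₄ + (∑ i, D.A i * P.Q i ^ 2) - D.B ≤ 0) (hp₁ : 0 < p₁) (hp₃ : 0 < p₃)
    (hp₁₂ : TransformBounds P K M p₁ p₂) (hp₃₄ : LyapunovBounds P D p₃ p₄)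
    (hκ : κ ≤ decayRate P D p₁ p₃) (hκη : κ ≤ D.η) (hτ : τ ∈ timeDomain (⨆ k, tk k)) :
    lyapunov P D (u τ) (backstep K M (u τ) (v τ)) - m τ ≤
      Real.exp (-(κ * τ)) * (lyapunov P D (u 0) (backstep K M (u 0) (v 0)) - m 0) := by
  have hdecay := ((h.solution.isPrimitive_lyapunov D hτ hKM).sub
    (h.isPrimitive_m hτ)).gronwall_le hτ.1 <| ae_of_all _ fun r hr =>
      have hrT := Icc_subset_timeDomain hτ (Ioc_subset_Icc_self hr)
      h.lyapunovRate_sub_mRate_le hKM hGN hA hμ hsel hsel₄ hp₁ hp₃ hp₁₂ hp₃₄ hκ hκη hrT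
        (h.m_neg hζ hς hς₄ hrT).le
  simpa only [sub_zero, neg_mul] using hdecay

theorem initial_lyapunov_sub_m_le (h : IsClosedLoop P D K M G N u v Ud m tk)
    (hp₁₂ : TransformBounds P K M p₁ p₂) (hp₃₄ : LyapunovBounds P D p₃ p₄) (hp₄ : 0 ≤ p₄)
    (h₀ : (0 : ℝ) ∈ timeDomain (⨆ k, tk k)) (hϑ : InL2 P.L (u 0) (backstep K M (u 0) (v 0))) :
    lyapunov P D (u 0) (backstep K M (u 0) (v 0)) - m 0 ≤
      max 1 (p₂ * p₄) * (normSq P.L (u 0) (v 0) - m 0) := by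
  have hn := normSq_nonneg P.L_pos.le (u 0) (v 0)
  calc lyapunov P D (u 0) (backstep K M (u 0) (v 0)) - m 0
      ≤ p₄ * (p₂ * normSq P.L (u 0) (v 0)) + 1 * -m 0 := by
        rw [one_mul, ← sub_eq_add_neg]
        gcongr
        exact (hp₃₄ _ _ hϑ).2.trans
          (mul_le_mul_of_nonneg_left (hp₁₂ _ _ (h.solution.inL2 0 h₀)).2 hp₄)
    _ = p₂ * p₄ * normSq P.L (u 0) (v 0) + 1 * -m 0 := by ring
    _ ≤ max 1 (p₂ * p₄) * normSq P.L (u 0) (v 0) + max 1 (p₂ * p₄) * -m 0 :=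
        add_le_add (mul_le_mul_of_nonneg_right (le_max_right _ _) hn)
          (mul_le_mul_of_nonneg_right (le_max_left _ _) (neg_nonneg.2 h.m_zero.le))
    _ = max 1 (p₂ * p₄) * (normSq P.L (u 0) (v 0) - m 0) := by ring

end IsClosedLoop

theorem expConverges_of_normSq_le {L κ C : ℝ} {T : EReal} {u : ℝ → ℝ → Fin 3 → ℝ}
    {v : ℝ → ℝ → ℝ}
    (h : ∀ t ∈ timeDomain T, normSq L (u t) (v t) ≤ C * Real.exp (-(κ * t))) :
    ExpConverges L (κ / 2) T u v := by
  refine ⟨√C, fun t ht => (Real.sqrt_le_sqrt (h t ht)).trans_eq ?_⟩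
  rw [Real.sqrt_mul' _ (Real.exp_pos _).le, ← Real.exp_half]
  ring_nf

end MixedTraffic

end

theorem theorem3_general (P : MixedTraffic.Plant) (D : MixedTraffic.Design)
    (K : Fin 3 → ℝ × ℝ → ℝ) (M : ℝ × ℝ → ℝ) (G : Fin 3 → ℝ × ℝ → ℝ) (N : ℝ × ℝ → ℝ)
    (hKM : MixedTraffic.IsBacksteppingKernel P K M)
    (hGN : MixedTraffic.IsInverseKernel P K M G N)
    (hA : ∀ i, 0 ≤ D.A i) (hμ : 0 ≤ D.μ) (hζ : 0 < D.ζ)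
    (hς : ∀ i, 0 ≤ D.ς i) (hς₄ : 0 ≤ D.ς₄)
    (hsel : ∀ i, D.ς i - D.A i * Real.exp (-(D.μ * P.L / P.lam i)) ≤ 0)
    (hsel₄ : D.ς₄ + (∑ i, D.A i * P.Q i ^ 2) - D.B ≤ 0)
    (p₁ p₂ p₃ p₄ : ℝ) (hp₁ : 0 < p₁) (hp₃ : 0 < p₃) (hp₄ : 0 ≤ p₄)
    (hp₁₂ : MixedTraffic.TransformBounds P K M p₁ p₂)
    (hp₃₄ : MixedTraffic.LyapunovBounds P D p₃ p₄)
    (u : ℝ → ℝ → Fin 3 → ℝ) (v : ℝ → ℝ → ℝ) (Ud m : ℝ → ℝ) (tk : ℕ → EReal)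
    (hcl : MixedTraffic.IsClosedLoop P D K M G N u v Ud m tk) :
    ∀ t ∈ MixedTraffic.timeDomain (⨆ k, tk k),
      MixedTraffic.normSq P.L (u t) (v t) ≤
        max 1 (p₂ * p₄) / (p₁ * p₃) *
          Real.exp (-(min (MixedTraffic.decayRate P D p₁ p₃) D.η * t)) *
          (MixedTraffic.normSq P.L (u 0) (v 0) - m 0) := by
  intro t ht
  have h₀ := MixedTraffic.Icc_subset_timeDomain ht (left_mem_Icc.2 ht.1)
  have hϑ := fun r hr => hcl.solution.inL2_backstep (τ := r) hr
    (fun i => (hKM.K_smooth i).continuousOn) hKM.M_smooth.continuousOn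
  have hdecay := hcl.lyapunov_sub_m_le hKM hGN hA hμ hζ hς hς₄ hsel hsel₄ hp₁ hp₃ hp₁₂ hp₃₄
    (min_le_left _ D.η) (min_le_right _ _) ht
  have hinit := hcl.initial_lyapunov_sub_m_le hp₁₂ hp₃₄ hp₄ h₀ (hϑ 0 h₀)
  set E := Real.exp (-(min (MixedTraffic.decayRate P D p₁ p₃) D.η * t))
  have hlower : p₁ * p₃ * MixedTraffic.normSq P.L (u t) (v t) ≤
      MixedTraffic.lyapunov P D (u t) (MixedTraffic.backstep K M (u t) (v t)) := by
    rw [mul_comm p₁, mul_assoc]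
    exact (mul_le_mul_of_nonneg_left (hp₁₂ _ _ (hcl.solution.inL2 t ht)).1 hp₃.le).trans
      (hp₃₄ _ _ (hϑ t ht)).1
  rw [div_mul_eq_mul_div, div_mul_eq_mul_div, le_div_iff₀' (mul_pos hp₁ hp₃)]
  calc p₁ * p₃ * MixedTraffic.normSq P.L (u t) (v t)
      ≤ MixedTraffic.lyapunov P D (u t) (MixedTraffic.backstep K M (u t) (v t)) - m t := by
        linarith [hcl.m_neg hζ hς hς₄ ht]
    _ ≤ E * (max 1 (p₂ * p₄) * (MixedTraffic.normSq P.L (u 0) (v 0) - m 0)) :=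
        hdecay.trans (mul_le_mul_of_nonneg_left hinit (Real.exp_pos _).le)
    _ = _ := by ring

theorem theorem3 (P : MixedTraffic.Plant) (D : MixedTraffic.Design)
    (K : Fin 3 → ℝ × ℝ → ℝ) (M : ℝ × ℝ → ℝ) (G : Fin 3 → ℝ × ℝ → ℝ) (N : ℝ × ℝ → ℝ)
    (hKM : MixedTraffic.IsBacksteppingKernel P K M)
    (hGN : MixedTraffic.IsInverseKernel P K M G N)
    (hA : ∀ i, 0 < D.A i) (hB : 0 < D.B) (hμ : 0 < D.μ) (hσ : 0 < D.σ) (hζ : 0 < D.ζ)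
    (hη : D.η ∈ Set.Ioo (0 : ℝ) 1) (hς : ∀ i, D.ς i ∈ Set.Ioo (0 : ℝ) 1)
    (hς₄ : D.ς₄ ∈ Set.Ioo (0 : ℝ) 1)
    (hsel : ∀ i, D.ς i - D.A i * Real.exp (-(D.μ * P.L / P.lam i)) ≤ 0)
    (hsel₄ : D.ς₄ + (∑ i, D.A i * P.Q i ^ 2) - D.B ≤ 0)
    (p₁ p₂ p₃ p₄ : ℝ) (hp₁ : 0 < p₁) (hp₂ : 0 < p₂) (hp₃ : 0 < p₃) (hp₄ : 0 < p₄)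
    (hp₁₂ : MixedTraffic.TransformBounds P K M p₁ p₂)
    (hp₃₄ : MixedTraffic.LyapunovBounds P D p₃ p₄)
    (u : ℝ → ℝ → Fin 3 → ℝ) (v : ℝ → ℝ → ℝ) (Ud m : ℝ → ℝ) (tk : ℕ → EReal)
    (hcl : MixedTraffic.IsClosedLoop P D K M G N u v Ud m tk) :
    (0 < MixedTraffic.decayRate P D p₁ p₃ →
      MixedTraffic.ExpConverges P.L (min (MixedTraffic.decayRate P D p₁ p₃) D.η / 2)
        (⨆ k, tk k) u v) ∧
    (MixedTraffic.decayRate P D p₁ p₃ ≤ D.η →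
      ∀ t ∈ MixedTraffic.timeDomain (⨆ k, tk k),
        MixedTraffic.normSq P.L (u t) (v t) ≤
          max 1 (p₂ * p₄) / (p₁ * p₃) *
            Real.exp (-(MixedTraffic.decayRate P D p₁ p₃ * t)) *
            (MixedTraffic.normSq P.L (u 0) (v 0) - m 0)) := by
  have h := theorem3_general P D K M G N hKM hGN (fun i => (hA i).le) hμ.le hζ
    (fun i => (hς i).1.le) hς₄.1.le hsel hsel₄ p₁ p₂ p₃ p₄ hp₁ hp₃ hp₄.le hp₁₂ hp₃₄ u v Ud m tk hcl
  exact ⟨fun _ => MixedTraffic.expConverges_of_normSq_le fun t ht =>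
      (h t ht).trans_eq (mul_right_comm _ _ _),
    fun hc => by simpa only [min_eq_left hc] using h⟩
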